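/- \textbf{Notation.} Write a dual quaternion as $x=h+\varepsilon h'$ with $h,h'\in\mathbb H$, $\varepsilon^2=0$, and $x^*=h^*+\varepsilon h'^*$; let $\mathcal S=\{x: xx^*=1\}$ be the set of unit dual quaternions, that is, of all $x=r+\varepsilon\frac12 p\,r$ with $r\in\mathbb S^3$ and $p$ a pure quaternion. If $r=\cos\frac{\phi}{2}+\sin\frac{\phi}{2}\,n$ with $\phi\in[0,2\pi)$ and $n$ a pure unit quaternion (possible exactly when $r\neq-1$), put $\log x=\frac12(\phi\,n+\varepsilon p)$. Let $\mathrm{vec}_6,\mathrm{vec}_8$ be the coordinate vectors of pure, respectively arbitrary, dual quaternions, and let $\overset{-}{H}_8(x)$ be the matrix with $\mathrm{vec}_8(gx)=\overset{-}{H}_8(x)\,\mathrm{vec}_8\,g$; similarly, for quaternions, $\mathrm{vec}_4(gh)=\overset{+}{H}_4(g)\,\mathrm{vec}_4 h=\overset{-}{H}_4(h)\,\mathrm{vec}_4 g$. Put $$Q_8(x)=\begin{bmatrix}Q(r)&0\\ \tfrac12\overset{+}{H}_4(p)\,Q(r)&\overset{-}{H}_4(r)\begin{bmatrix}0\\ I_3\end{bmatrix}\end{bmatrix},\qquad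 Q(r)=\begin{bmatrix}-\vec r^{\,T}\\ \Gamma\,\vec n\vec n^{T}+\Theta I_3\end{bmatrix},$$ where $\vec r,\vec n\in\mathbb R^3$ are the imaginary parts of $r,n$, $\Theta=\frac{\sin(\phi/2)}{\phi/2}$ ($\Theta=1$ if $\phi=0$) and $\Gamma=\mathrm{Re}\,r-\Theta$. \textbf{Setting.} Let $n\ge1$, let $\mathcal G$ be a simple directed graph on the nodes $1,\dots,n$, and let $A=[a_{ij}]$ be a matrix of weights for it: $a_{ij}>0$ if $\mathcal G$ has the edge from $j$ to $i$, and $a_{ij}=0$ otherwise, with $a_{ii}=0$. For each $i$ let $\delta_i:[0,\infty)\to\mathcal S$ be differentiable (the desired time-varying pose relative to the centre of formation). The $n$ agents have poses $x_i(t)\in\mathcal S$, $t\ge0$; put $x_{c,i}=x_i\delta_i^*$ (agent $i$'s opinion on the centre of formation) and $y_{c,i}=\log x_{c,i}$ (its output). The initial poses are those for which the outputs are defined, i.e. the rotation part of every $x_{c,i}(0)$ differs from $-1$. The agents move, for all $t\ge0$, according to $\mathrm{vec}_8\,\dot x_i=\mathrm{vec}_8\,u_{x,i}$ with $$\mathrm{vec}_8\,u_{x,i}=-\overset{-}{H}_8(\delta_i)\,Q_8(x_{c,i})\sum_{j=1}^n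 a_{ij}\,\mathrm{vec}_6\,(y_{c,i}-y_{c,j})-\mathrm{vec}_8\big(x_i\,\dot\delta_i^{*}\,\delta_i\big).$$ \textbf{Theorem.} From all such initial poses there is a motion of the agents defined for all $t\ge0$, and along every motion the outputs stay defined (the rotation part of $x_{c,i}(t)$ is never $-1$). Moreover, the following are equivalent: \begin{enumerate} \item $\mathcal G$ has a directed spanning tree; \item the system asymptotically achieves output consensus: along every motion, $\lim_{t\to\infty}\big(y_{c,i}(t)-y_{c,j}(t)\big)=0$ for all $i,j$; \item the system asymptotically achieves the time-varying formation: along every motion there is a centre of formation $x_c\in\mathcal S$ with $\lim_{t\to\infty}x_i(t)\,\delta_i(t)^*=x_c$ for all $i$. \end{enumerate} -/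

import Mathlib

open scoped Quaternion DualNumber Topology

noncomputable section

/-! ### Directed graphs -/

/-- `a` is a matrix of weights for the simple directed graph `G`: `a i j` is positive when `G` has
the edge from `j` (parent) to `i` (child), and zero otherwise; there are no self-loops. -/
structure IsAdjacencyMatrix {n : ℕ} (G : Digraph (Fin n)) (a : Matrix (Fin n) (Fin n) ℝ) :
    Prop where
  diag_eq_zero : ∀ i, a i i = 0
  eq_zero : ∀ i j, ¬ G.Adj j i → a i j = 0
  pos_iff : ∀ i j, 0 < a i j ↔ G.Adj j i

/-- A directed tree: a root without parents, every other node has exactly one parent, and every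
node can be reached from the root along directed edges. (The directed path from the root to a node
is then automatically unique.) -/
def IsDirectedTree {V : Type*} (T : Digraph V) : Prop :=
  ∃ root : V, (∀ u, ¬ T.Adj u root) ∧ (∀ v, v ≠ root → ∃! u, T.Adj u v) ∧
    ∀ v, Relation.ReflTransGen T.Adj root v

/-- Some edges of `G` can be removed so that a directed tree on all the nodes remains. -/
def HasDirectedSpanningTree {V : Type*} (G : Digraph V) : Prop :=
  ∃ T : Digraph V, T ≤ G ∧ IsDirectedTree T

/-! ### Dual quaternions -/

/-- Dual quaternions `h + ε h'`, with `h = x.fst` and `h' = x.snd`. -/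
abbrev DualQuat : Type := DualNumber (Quaternion ℝ)

namespace DualQuat

/-- The conjugate `h* + ε h'*`. -/
def conj (x : DualQuat) : DualQuat := TrivSqZeroExt.inl (star x.fst) + TrivSqZeroExt.inr (star x.snd)

/-- Unit dual quaternions (rigid motions): the norm, which is the square root of the dual number
`x x*`, is one. -/
def IsUnitNorm (x : DualQuat) : Prop := x * conj x = 1

/-- The translation `p` of the unit dual quaternion `x = r + ε (1/2) p r`. -/
def translation (x : DualQuat) : ℍ[ℝ] := (2 : ℝ) • (x.snd * star x.fst)

/-- The rotation angle `φ ∈ [0, 2π)` of a unit quaternion `r = cos (φ/2) + sin (φ/2) n ≠ -1`. -/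
def rotAngle (r : ℍ[ℝ]) : ℝ := 2 * Real.arccos r.re

/-- The rotation axis `n` of a unit quaternion `r = cos (φ/2) + sin (φ/2) n` (it is `0` when `r`
is real, where the axis is not determined). -/
def rotAxis (r : ℍ[ℝ]) : ℍ[ℝ] := ‖r.im‖⁻¹ • r.im

/-- The logarithm `(φ/2) n` of a unit quaternion `r = cos (φ/2) + sin (φ/2) n`, `φ ∈ [0, 2π)`;
only meaningful for `r ≠ -1`. -/
def qlog (r : ℍ[ℝ]) : ℍ[ℝ] := (rotAngle r / 2) • rotAxis r

/-- The logarithm `(1/2) (φ n + ε p)` of a unit dual quaternion. -/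
def log (x : DualQuat) : DualQuat :=
  TrivSqZeroExt.inl (qlog x.fst) + TrivSqZeroExt.inr ((1 / 2 : ℝ) • translation x)

/-- The poses at which the logarithm is defined: unit dual quaternions whose rotation angle can be
taken in `[0, 2π)`, that is, whose rotation part is not `-1`. -/
def InLogDomain (x : DualQuat) : Prop := IsUnitNorm x ∧ x.fst ≠ -1

/-! ### Coordinates and matrices -/

def vec3 (h : ℍ[ℝ]) : Fin 3 → ℝ := ![h.imI, h.imJ, h.imK]

def vec4 (h : ℍ[ℝ]) : Fin 4 → ℝ := ![h.re, h.imI, h.imJ, h.imK]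

/-- Coordinates of a pure dual quaternion; `Fin 3 ⊕ Fin 3` indexes `ℝ⁶`. -/
def vec6 (x : DualQuat) : Fin 3 ⊕ Fin 3 → ℝ := Sum.elim (vec3 x.fst) (vec3 x.snd)

/-- Coordinates of a dual quaternion; `Fin 4 ⊕ Fin 4` indexes `ℝ⁸`. -/
def vec8 (x : DualQuat) : Fin 4 ⊕ Fin 4 → ℝ := Sum.elim (vec4 x.fst) (vec4 x.snd)

/-- The Hamilton operator with `vec4 (h * g) = hamiPlus4 h *ᵥ vec4 g`. -/
def hamiPlus4 (h : ℍ[ℝ]) : Matrix (Fin 4) (Fin 4) ℝ :=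
  !![h.re, -h.imI, -h.imJ, -h.imK;
     h.imI, h.re, -h.imK, h.imJ;
     h.imJ, h.imK, h.re, -h.imI;
     h.imK, -h.imJ, h.imI, h.re]

/-- The Hamilton operator with `vec4 (g * h) = hamiMinus4 h *ᵥ vec4 g`. -/
def hamiMinus4 (h : ℍ[ℝ]) : Matrix (Fin 4) (Fin 4) ℝ :=
  !![h.re, -h.imI, -h.imJ, -h.imK;
     h.imI, h.re, h.imK, -h.imJ;
     h.imJ, -h.imK, h.re, h.imI;
     h.imK, h.imJ, -h.imI, h.re]

/-- The Hamilton operator with `vec8 (g * x) = hamiMinus8 x *ᵥ vec8 g`. -/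
def hamiMinus8 (x : DualQuat) : Matrix (Fin 4 ⊕ Fin 4) (Fin 4 ⊕ Fin 4) ℝ :=
  Matrix.fromBlocks (hamiMinus4 x.fst) 0 (hamiMinus4 x.snd) (hamiMinus4 x.fst)

/-- The matrix `Q(r)` of partial derivatives of the coordinates of a unit quaternion `r` with
respect to those of its logarithm, where `Θ = sin (φ/2) / (φ/2)` (and `Θ = 1` for `φ = 0`) and
`Γ = Re r - Θ`. -/
def matQ (r : ℍ[ℝ]) : Matrix (Fin 4) (Fin 3) ℝ :=
  let n := rotAxis r
  let Θ := Real.sinc (rotAngle r / 2)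
  let Γ := r.re - Θ
  !![-r.imI, -r.imJ, -r.imK;
     Γ * n.imI ^ 2 + Θ, Γ * n.imI * n.imJ, Γ * n.imI * n.imK;
     Γ * n.imJ * n.imI, Γ * n.imJ ^ 2 + Θ, Γ * n.imJ * n.imK;
     Γ * n.imK * n.imI, Γ * n.imK * n.imJ, Γ * n.imK ^ 2 + Θ]

def matQp : Matrix (Fin 4) (Fin 3) ℝ := !![0, 0, 0; 1, 0, 0; 0, 1, 0; 0, 0, 1]

/-- The `8 × 6` matrix relating the derivative of a unit dual quaternion to that of its
logarithm. -/
def matQ8 (x : DualQuat) : Matrix (Fin 4 ⊕ Fin 4) (Fin 3 ⊕ Fin 3) ℝ :=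
  Matrix.fromBlocks (matQ x.fst) 0
    ((1 / 2 : ℝ) • (hamiPlus4 (translation x) * matQ x.fst)) (hamiMinus4 x.fst * matQp)

end DualQuat

/-! ### The closed-loop multi-agent system -/

section ClosedLoop

open DualQuat

/-- Agent `i`'s opinion `x_i(t) δ_i(t)*` on the centre of formation. -/
def center {n : ℕ} (δ x : Fin n → ℝ → DualQuat) (i : Fin n) (t : ℝ) : DualQuat :=
  x i t * conj (δ i t)

/-- Agent `i`'s output, the logarithm of its opinion on the centre of formation. -/
def output {n : ℕ} (δ x : Fin n → ℝ → DualQuat) (i : Fin n) (t : ℝ) : DualQuat :=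
  DualQuat.log (center δ x i t)

/-- The input prescribed to agent `i` by the time-varying formation protocol, as a vector of `ℝ⁸`.
The time derivative of `δ_i*` is the one on the time interval `[0, ∞)`. -/
def protocolInput {n : ℕ} (a : Matrix (Fin n) (Fin n) ℝ) (δ x : Fin n → ℝ → DualQuat)
    (i : Fin n) (t : ℝ) : Fin 4 ⊕ Fin 4 → ℝ :=
  -((hamiMinus8 (δ i t)).mulVec ((matQ8 (center δ x i t)).mulVec
      (∑ j, a i j • vec6 (output δ x i t - output δ x j t))))
    - vec8 (x i t * derivWithin (fun s => conj (δ i s)) (Set.Ici 0) t * δ i t)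

/-- `x` is a motion of the agents on `[0, ∞)`, through rigid-body poses, starting where the outputs
are defined, and driven by the protocol. -/
structure IsClosedLoopMotion {n : ℕ} (a : Matrix (Fin n) (Fin n) ℝ)
    (δ x : Fin n → ℝ → DualQuat) : Prop where
  isUnitNorm : ∀ i t, 0 ≤ t → IsUnitNorm (x i t)
  init : ∀ i, InLogDomain (center δ x i 0)
  dynamics : ∀ i t, 0 ≤ t → ∃ x' : DualQuat,
    HasDerivWithinAt (x i) x' (Set.Ici 0) t ∧ vec8 x' = protocolInput a δ x i t

/-- Along every motion, the outputs of any two agents asymptotically agree. -/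
def AchievesOutputConsensus {n : ℕ} (a : Matrix (Fin n) (Fin n) ℝ)
    (δ : Fin n → ℝ → DualQuat) : Prop :=
  ∀ x : Fin n → ℝ → DualQuat, IsClosedLoopMotion a δ x →
    ∀ i j, Filter.Tendsto (fun t => output δ x i t - output δ x j t) Filter.atTop (𝓝 0)

/-- Along every motion, the opinions of all the agents on the centre of formation converge to one
common pose. -/
def AchievesFormation {n : ℕ} (a : Matrix (Fin n) (Fin n) ℝ)
    (δ : Fin n → ℝ → DualQuat) : Prop :=
  ∀ x : Fin n → ℝ → DualQuat, IsClosedLoopMotion a δ x →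
    ∃ xc : DualQuat, IsUnitNorm xc ∧
      ∀ i, Filter.Tendsto (center δ x i) Filter.atTop (𝓝 xc)

end ClosedLoop

end

noncomputable section

/-! ### Roots of directed graphs -/

/-! The feedback is an exact linearisation. The matrix $Q_8$ is the Jacobian of the exponential in
logarithmic coordinates, and the last term of the input cancels the drift of $\delta_i$. So wherever
the logarithms are defined, the outputs solve $\dot y_i=-\sum_j a_{ij}(y_i-y_j)$, whose solution is
$y(t)=e^{-tL}y(0)$ (`hasDerivWithinAt_log`, `IsClosedLoopMotion.output_eq`).

For $t\ge0$ the matrix $e^{-tL}$ is nonnegative with row sums 1. Rotation vectors therefore stay in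
a closed ball of radius less than $\pi$, and a first-exit argument shows that no pose reaches
rotation $-1$ (`IsClosedLoopMotion.inLogDomain`). Conversely, exponentiating the linear flow gives a
motion (`exists_isClosedLoopMotion`).

A spanning tree amounts to a root that reaches every node. Then the root's column of $e^{-L}$ is
positive, averaging contracts, and $e^{-tL}$ tends to a matrix with equal rows
(`exists_tendsto_consensusFlow`); continuity of the exponential carries the common limit to the
poses. Without a root, two disjoint sets of nodes receive no information from outside. Different
initial outputs on them persist forever, and since the logarithm inverts the exponential the poses
stay apart as well (`exists_motion_of_not_hasDirectedSpanningTree`). -/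

theorem exists_root_of_hasDirectedSpanningTree {V : Type*} {G : Digraph V}
    (h : HasDirectedSpanningTree G) : ∃ r, ∀ v, Relation.ReflTransGen G.Adj r v := by
  obtain ⟨T, hT, r, -, -, hr⟩ := h
  exact ⟨r, fun v => Relation.ReflTransGen.mono (fun a b hab => hT hab) _ _ (hr v)⟩

/-- Breadth-first search: each node other than the root keeps one incoming edge, from a node
strictly closer to the root. -/
theorem hasDirectedSpanningTree_of_root {V : Type*} {G : Digraph V} {r : V}
    (h : ∀ v, Relation.ReflTransGen G.Adj r v) : HasDirectedSpanningTree G := by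
  classical
  -- `R k v`: some walk of length `k` leads from `r` to `v`.
  let R : ℕ → V → Prop := fun k v => Nat.rec (motive := fun _ => V → Prop) (· = r)
    (fun _ P v => ∃ u, P u ∧ G.Adj u v) k v
  have hex : ∀ v, ∃ k, R k v := by
    intro v
    induction h v with
    | refl => exact ⟨0, rfl⟩
    | tail _ hab ih => obtain ⟨k, hk⟩ := ih; exact ⟨k + 1, _, hk, hab⟩
  let d : V → ℕ := fun v => sInf {k | R k v}
  have hpar : ∀ v, v ≠ r → ∃ u, G.Adj u v ∧ d u < d v := by
    intro v hv
    have hd : R (d v) v := Nat.sInf_mem (s := {k | R k v}) (hex v)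
    rcases hk : d v with _ | k
    · rw [hk] at hd; exact absurd hd hv
    · rw [hk] at hd
      obtain ⟨u, hu, huv⟩ := hd
      exact ⟨u, huv, Nat.lt_succ_of_le (Nat.sInf_le (s := {k | R k u}) hu)⟩
  choose! par hadj hlt using hpar
  refine ⟨⟨fun u v => v ≠ r ∧ u = par v⟩, ?_, r, ?_, ?_, ?_⟩
  · rintro u v ⟨hv, rfl⟩
    exact hadj v hv
  · rintro u ⟨hu, -⟩
    exact hu rfl
  · intro v hv
    exact ⟨par v, ⟨hv, rfl⟩, fun u hu => hu.2⟩
  · intro v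
    induction hd : d v using Nat.strong_induction_on generalizing v with
    | _ k ih =>
      by_cases hv : v = r
      · rw [hv]
      · exact (ih (d (par v)) (hd ▸ hlt v hv) (par v) rfl).tail ⟨hv, rfl⟩

/-- Without a root there are two disjoint nonempty sets of nodes that are closed under taking
parents. -/
theorem exists_disjoint_closed_of_no_root {V : Type*} [Finite V] [Nonempty V] {G : Digraph V}
    (h : ¬ ∃ r, ∀ v, Relation.ReflTransGen G.Adj r v) :
    ∃ A B : Set V, A.Nonempty ∧ B.Nonempty ∧ Disjoint A B ∧
      (∀ u v, G.Adj u v → v ∈ A → u ∈ A) ∧ (∀ u v, G.Adj u v → v ∈ B → u ∈ B) := by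
  let anc : V → Set V := fun v => {u | Relation.ReflTransGen G.Adj u v}
  -- By minimality every ancestor `z` of `u` has the same ancestors as `u`, among them `u` itself.
  -- An ancestor shared with `w` would thus make `u` reach `w`.
  obtain ⟨u, hu⟩ := Finite.exists_min (fun v => (anc v).ncard)
  push Not at h
  obtain ⟨w, hw⟩ := h u
  refine ⟨anc u, anc w, ⟨u, .refl⟩, ⟨w, .refl⟩, ?_, fun a b hab hb => .head hab hb,
    fun a b hab hb => .head hab hb⟩
  rw [Set.disjoint_left]
  intro z hzu hzw
  have hsub : anc z ⊆ anc u := fun a ha => Relation.ReflTransGen.trans ha hzu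
  have heq : anc z = anc u := Set.eq_of_subset_of_ncard_le hsub (hu z) (Set.toFinite _)
  have : u ∈ anc z := heq ▸ (Relation.ReflTransGen.refl : u ∈ anc u)
  exact hw (Relation.ReflTransGen.trans this hzw)

/-! ### The consensus flow -/

section Flow

variable {ι : Type*} [Fintype ι] [DecidableEq ι]

/-- The negative of the Laplacian matrix. -/
def negLaplacian (a : Matrix ι ι ℝ) : Matrix ι ι ℝ := a - Matrix.diagonal fun i => ∑ j, a i j

/-- The flow of the linear consensus system. -/
def consensusFlow (a : Matrix ι ι ℝ) (t : ℝ) : Matrix ι ι ℝ :=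
  NormedSpace.exp (t • negLaplacian a)

theorem consensusFlow_zero (a : Matrix ι ι ℝ) : consensusFlow a 0 = 1 := by
  simp [consensusFlow]

theorem consensusFlow_add (a : Matrix ι ι ℝ) (s t : ℝ) :
    consensusFlow a (s + t) = consensusFlow a s * consensusFlow a t := by
  rw [consensusFlow, add_smul, Matrix.exp_add_of_commute]
  · rfl
  · exact ((Commute.refl _).smul_left s).smul_right t

theorem Matrix.pow_apply_nonneg_of_nonneg {B : Matrix ι ι ℝ} (hB : ∀ i j, 0 ≤ B i j) (k : ℕ) :
    ∀ i j, 0 ≤ (B ^ k) i j := by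
  induction k with
  | zero => intro i j; simp only [pow_zero, Matrix.one_apply]; split_ifs <;> norm_num
  | succ k ih =>
    intro i j
    rw [pow_succ, Matrix.mul_apply]
    exact Finset.sum_nonneg fun k _ => mul_nonneg (ih _ _) (hB _ _)

section Deriv

attribute [local instance] Matrix.linftyOpNormedRing Matrix.linftyOpNormedAlgebra

theorem hasDerivAt_consensusFlow_apply (a : Matrix ι ι ℝ) (t : ℝ) (i j : ι) :
    HasDerivAt (fun t => consensusFlow a t i j) ((consensusFlow a t * negLaplacian a) i j) t := by
  have h := hasDerivAt_exp_smul_const (𝕂 := ℝ) (negLaplacian a) t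
  let e : Matrix ι ι ℝ →ₗ[ℝ] ℝ := Matrix.entryLinearMap ℝ ℝ i j
  exact (LinearMap.toContinuousLinearMap e).hasFDerivAt.comp_hasDerivAt t h

theorem hasDerivAt_consensusFlow_apply' (a : Matrix ι ι ℝ) (t : ℝ) (i j : ι) :
    HasDerivAt (fun t => consensusFlow a t i j) ((negLaplacian a * consensusFlow a t) i j) t := by
  have h := hasDerivAt_exp_smul_const' (𝕂 := ℝ) (negLaplacian a) t
  let e : Matrix ι ι ℝ →ₗ[ℝ] ℝ := Matrix.entryLinearMap ℝ ℝ i j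
  exact (LinearMap.toContinuousLinearMap e).hasFDerivAt.comp_hasDerivAt t h

/-- All terms of the series are nonnegative, so each bounds the sum from below. The term `m = 0`
gives nonnegativity of the flow, and a walk of length `m` gives positivity. -/
theorem Matrix.pow_apply_div_factorial_le_exp {B : Matrix ι ι ℝ} (hB : ∀ i j, 0 ≤ B i j) (m : ℕ)
    (i j : ι) : (m.factorial : ℝ)⁻¹ * (B ^ m) i j ≤ NormedSpace.exp B i j := by
  have h := NormedSpace.exp_series_hasSum_exp' (𝕂 := ℝ) B
  let e : Matrix ι ι ℝ →ₗ[ℝ] ℝ := Matrix.entryLinearMap ℝ ℝ i j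
  have h2 := (LinearMap.toContinuousLinearMap e).hasSum h
  exact le_hasSum h2 m fun k _ =>
    mul_nonneg (by positivity) (Matrix.pow_apply_nonneg_of_nonneg hB k i j)

end Deriv

theorem negLaplacian_mulVec_one (a : Matrix ι ι ℝ) (i : ι) : ∑ j, negLaplacian a i j = 0 := by
  simp [negLaplacian, Matrix.diagonal_apply]

/-- The Laplacian kills constant vectors, so row sums have zero derivative. -/
theorem sum_consensusFlow (a : Matrix ι ι ℝ) (t : ℝ) (i : ι) : ∑ j, consensusFlow a t i j = 1 := by
  have hd : ∀ s, HasDerivAt (fun s => ∑ j, consensusFlow a s i j) 0 s := by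
    intro s
    have := HasDerivAt.fun_sum (u := Finset.univ)
      fun j _ => hasDerivAt_consensusFlow_apply a s i j
    refine this.congr_deriv ?_
    simp only [Matrix.mul_apply]
    rw [Finset.sum_comm]
    simp [← Finset.mul_sum, negLaplacian_mulVec_one]
  have := is_const_of_deriv_eq_zero (fun s => (hd s).differentiableAt) (fun s => (hd s).deriv) t 0
  rw [this, consensusFlow_zero]
  simp [Matrix.one_apply]

theorem sum_negLaplacian_smul {F : Type*} [AddCommGroup F] [Module ℝ F] (a : Matrix ι ι ℝ)
    (y : ι → F) (i : ι) : ∑ j, negLaplacian a i j • y j = -∑ j, a i j • (y i - y j) := by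
  simp [negLaplacian, Matrix.diagonal_apply, sub_smul, smul_sub, Finset.sum_sub_distrib,
    Finset.sum_smul, ite_smul]

/-- A nonnegative shift of the negative Laplacian. -/
theorem exists_shift_nonneg {a : Matrix ι ι ℝ} (ha : ∀ i j, 0 ≤ a i j) :
    ∃ k : ℝ, ∀ i j, a i j ≤ (negLaplacian a + k • 1) i j := by
  -- The total weight dominates every row sum, hence compensates the negative diagonal.
  refine ⟨∑ i, ∑ j, a i j, fun i j => ?_⟩
  have h1 : ∑ j, a i j ≤ ∑ i, ∑ j, a i j :=
    Finset.single_le_sum (f := fun i => ∑ j, a i j)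
      (fun i _ => Finset.sum_nonneg fun j _ => ha i j) (Finset.mem_univ i)
  by_cases hij : i = j
  · subst hij
    simp [negLaplacian]
    linarith
  · simp [negLaplacian, hij]

theorem consensusFlow_eq_shift (a : Matrix ι ι ℝ) (k t : ℝ) :
    consensusFlow a t = Real.exp (-(t * k)) • NormedSpace.exp (t • (negLaplacian a + k • 1)) := by
  have h1 : t • negLaplacian a
      = Matrix.diagonal (fun _ : ι => -(t * k)) + t • (negLaplacian a + k • 1) := by
    ext i j
    by_cases hij : i = j
    · subst hij; simp
    · simp [hij]
  have h2 : Matrix.diagonal (fun _ : ι => -(t * k)) = (-(t * k)) • (1 : Matrix ι ι ℝ) := by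
    ext i j; simp [Matrix.diagonal_apply, Matrix.one_apply]
  rw [consensusFlow, h1, Matrix.exp_add_of_commute, Matrix.exp_diagonal]
  · have h3 : NormedSpace.exp (fun _ : ι => -(t * k)) = fun _ => Real.exp (-(t * k)) := by
      ext i; rw [Pi.coe_exp, Real.exp_eq_exp_ℝ]
    rw [h3]
    ext i j
    simp [Matrix.diagonal_mul]
  · rw [h2]
    exact (Commute.one_left _).smul_left _

theorem consensusFlow_nonneg {a : Matrix ι ι ℝ} (ha : ∀ i j, 0 ≤ a i j) {t : ℝ} (ht : 0 ≤ t)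
    (i j : ι) : 0 ≤ consensusFlow a t i j := by
  obtain ⟨k, hk⟩ := exists_shift_nonneg ha
  rw [consensusFlow_eq_shift a k]
  have h := Matrix.pow_apply_div_factorial_le_exp (B := t • (negLaplacian a + k • 1))
    (fun i j => mul_nonneg ht ((ha i j).trans (hk i j))) 0 i j
  refine mul_nonneg (Real.exp_pos _).le (le_trans ?_ h)
  simp only [pow_zero, Matrix.one_apply]; split_ifs <;> norm_num

theorem consensusFlow_one_pos {a : Matrix ι ι ℝ} (ha : ∀ i j, 0 ≤ a i j) {i j : ι}
    (hij : Relation.ReflTransGen (fun u v => 0 < a v u) j i) : 0 < consensusFlow a 1 i j := by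
  obtain ⟨k, hk⟩ := exists_shift_nonneg ha
  set B := negLaplacian a + k • 1
  have hB : ∀ i j, 0 ≤ B i j := fun i j => (ha i j).trans (hk i j)
  have hm : ∃ m : ℕ, 0 < (B ^ m) i j := by
    induction hij with
    | refl => exact ⟨0, by simp⟩
    | @tail u v _ huv ih =>
      obtain ⟨m, hm⟩ := ih
      refine ⟨m + 1, ?_⟩
      rw [pow_succ', Matrix.mul_apply]
      exact (mul_pos (huv.trans_le (hk v u)) hm).trans_le (Finset.single_le_sum
        (f := fun w => B v w * (B ^ m) w j)
        (fun w _ => mul_nonneg (hB v w) (Matrix.pow_apply_nonneg_of_nonneg hB m w j))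
        (Finset.mem_univ u))
  obtain ⟨m, hm⟩ := hm
  rw [consensusFlow_eq_shift a k, one_smul]
  exact mul_pos (Real.exp_pos _)
    ((mul_pos (by positivity) hm).trans_le (Matrix.pow_apply_div_factorial_le_exp hB m i j))

/-- Solutions of the linear consensus system are given by the flow. -/
theorem eq_sum_consensusFlow_smul {F : Type*} [NormedAddCommGroup F] [NormedSpace ℝ F]
    {a : Matrix ι ι ℝ} {y : ι → ℝ → F} {T : ℝ} (hT : 0 ≤ T)
    (hy : ∀ i, ∀ t ∈ Set.Icc 0 T,
      HasDerivWithinAt (y i) (∑ j, negLaplacian a i j • y j t) (Set.Ici 0) t) (i : ι) :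
    y i T = ∑ j, consensusFlow a T i j • y j 0 := by
  -- This function runs from the flow applied to `y 0` at `s = 0` to `y T` at `s = T`; that it is
  -- constant is the claim.
  have hd : ∀ t ∈ Set.Icc 0 T,
      HasDerivWithinAt (fun s => ∑ j, consensusFlow a (T - s) i j • y j s) 0 (Set.Icc 0 T) t := by
    intro t ht
    have h1 : ∀ j, HasDerivWithinAt (fun s => consensusFlow a (T - s) i j)
        (-(consensusFlow a (T - t) * negLaplacian a) i j) (Set.Icc 0 T) t := by
      intro j
      have h := (hasDerivAt_consensusFlow_apply a (T - t) i j).comp_const_sub T t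
      exact h.hasDerivWithinAt
    have h2 := HasDerivWithinAt.fun_sum (u := Finset.univ) fun j _ =>
      (h1 j).fun_smul ((hy j t ht).mono (Set.Icc_subset_Ici_self))
    refine h2.congr_deriv ?_
    simp only [Finset.sum_add_distrib, Matrix.mul_apply, neg_smul, Finset.sum_smul,
      Finset.smul_sum, Finset.sum_neg_distrib, smul_smul]
    rw [Finset.sum_comm, add_neg_cancel]
  have hc := constant_of_has_deriv_right_zero
    (fun t ht => (hd t ht).continuousWithinAt)
    (fun t ht => (hd t ⟨ht.1, ht.2.le⟩).mono_of_mem_nhdsWithin (Icc_mem_nhdsGE_of_mem ht))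
    T ⟨hT, le_rfl⟩
  simpa [consensusFlow_zero, Matrix.one_apply, ite_smul] using hc

end Flow

/-! ### Convergence of the flow when there is a root -/

section FlowLimit

variable {ι : Type*} [Fintype ι] [DecidableEq ι]

/-- Setting aside weight `η` at `r` leaves nonnegative weights of total `1 - η`. Averages sharing
this weight lie in an interval shorter by the factor `1 - η`. -/
theorem sum_mul_mem_of_mem_interval {w y : ι → ℝ} (hw : ∀ k, 0 ≤ w k) (hw1 : ∑ k, w k = 1)
    {l u : ℝ} (hy : ∀ k, l ≤ y k ∧ y k ≤ u) {r : ι} {η : ℝ} (hη : η ≤ w r) :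
    η * y r + (1 - η) * l ≤ ∑ k, w k * y k ∧ ∑ k, w k * y k ≤ η * y r + (1 - η) * u := by
  have key : ∀ c, ∑ k, w k * y k - (η * y r + (1 - η) * c)
      = ∑ k, (w k - if k = r then η else 0) * (y k - c) := by
    intro c
    simp only [sub_mul, mul_sub, Finset.sum_sub_distrib, ite_mul, zero_mul,
      Finset.sum_ite_eq', Finset.mem_univ, if_true, ← Finset.sum_mul, hw1]
    ring
  have hn : ∀ k, 0 ≤ w k - if k = r then η else 0 := by
    intro k
    split_ifs with h
    · subst h; linarith
    · simpa using hw k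
  constructor
  · have := Finset.sum_nonneg fun k (_ : k ∈ Finset.univ) =>
      mul_nonneg (hn k) (sub_nonneg.2 (hy k).1)
    linarith [key l]
  · have := Finset.sum_nonpos fun k (_ : k ∈ Finset.univ) =>
      mul_nonpos_of_nonneg_of_nonpos (hn k) (sub_nonpos.2 (hy k).2)
    linarith [key u]

/-- If some node reaches all the others, the consensus flow converges to a matrix with equal
rows. -/
theorem exists_tendsto_consensusFlow {a : Matrix ι ι ℝ} (ha : ∀ i j, 0 ≤ a i j) {r : ι}
    (hr : ∀ i, Relation.ReflTransGen (fun u v => 0 < a v u) r i) :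
    ∃ ν : ι → ℝ, ∀ i j, Filter.Tendsto (fun t => consensusFlow a t i j) Filter.atTop (𝓝 (ν j)) := by
  suffices h : ∀ j, ∃ ν : ℝ, ∀ i,
      Filter.Tendsto (fun t => consensusFlow a t i j) Filter.atTop (𝓝 ν) by
    choose ν hν using h
    exact ⟨ν, fun i j => hν j i⟩
  intro j
  have : Nonempty ι := ⟨r⟩
  obtain ⟨i₀, hi₀⟩ := Finite.exists_min fun i => consensusFlow a 1 i r
  set η := consensusFlow a 1 i₀ r
  have hη : 0 < η := consensusFlow_one_pos ha (hr i₀)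
  have hη1 : η ≤ 1 := by
    rw [← sum_consensusFlow a 1 i₀]
    exact Finset.single_le_sum (f := fun k => consensusFlow a 1 i₀ k)
      (fun k _ => consensusFlow_nonneg ha zero_le_one i₀ k) (Finset.mem_univ r)
  -- Each unit of time contracts the spread of column `j` by `1 - η`, since every row of the flow at
  -- time 1 has weight at least `η` at `r`.
  have hstep : ∀ m : ℕ, ∃ l, ∀ t : ℝ, m ≤ t → ∀ k,
      l ≤ consensusFlow a t k j ∧ consensusFlow a t k j ≤ l + (1 - η) ^ m := by
    intro m
    induction m with
    | zero =>
      refine ⟨0, fun t ht k => ?_⟩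
      have ht : 0 ≤ t := by simpa using ht
      refine ⟨consensusFlow_nonneg ha ht k j, ?_⟩
      rw [pow_zero, zero_add, ← sum_consensusFlow a t k]
      exact Finset.single_le_sum (f := fun j => consensusFlow a t k j)
        (fun j _ => consensusFlow_nonneg ha ht k j) (Finset.mem_univ j)
    | succ m ih =>
      obtain ⟨l, hl⟩ := ih
      have h1 : ∀ k, η * consensusFlow a m r j + (1 - η) * l ≤ consensusFlow a (1 + m) k j ∧
          consensusFlow a (1 + m) k j
            ≤ η * consensusFlow a m r j + (1 - η) * (l + (1 - η) ^ m) := by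
        intro k
        rw [consensusFlow_add, Matrix.mul_apply]
        exact sum_mul_mem_of_mem_interval (y := fun k => consensusFlow a m k j)
          (fun i => consensusFlow_nonneg ha zero_le_one k i) (sum_consensusFlow a 1 k)
          (hl m le_rfl) (hi₀ k)
      refine ⟨η * consensusFlow a m r j + (1 - η) * l, fun t ht k => ?_⟩
      have ht' : 0 ≤ t - (1 + m) := by push_cast at ht; linarith
      -- With `η = 0`: further averaging after time `1 + m` does not leave the interval.
      have h2 := sum_mul_mem_of_mem_interval (r := r) (η := 0)
        (y := fun k => consensusFlow a (1 + m) k j)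
        (fun i => consensusFlow_nonneg ha ht' k i) (sum_consensusFlow a _ k) h1
        (consensusFlow_nonneg ha ht' k r)
      rw [← Matrix.mul_apply, ← consensusFlow_add, sub_add_cancel] at h2
      refine ⟨by linarith [h2.1], h2.2.trans_eq ?_⟩
      ring
  have hsmall : ∀ κ > 0, ∃ m : ℕ, (1 - η) ^ m < κ := fun κ hκ =>
    exists_pow_lt_of_lt_one hκ (by linarith)
  have hclose : ∀ κ > 0, ∃ N : ℝ, ∀ s ≥ N, ∀ t ≥ N, ∀ i k,
      dist (consensusFlow a s i j) (consensusFlow a t k j) < κ := by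
    intro κ hκ
    obtain ⟨m, hm⟩ := hsmall κ hκ
    obtain ⟨l, hl⟩ := hstep m
    refine ⟨m, fun s hs t ht i k => ?_⟩
    rw [Real.dist_eq, abs_lt]
    constructor <;> linarith [hl s hs i, hl t ht k]
  have hcauchy : CauchySeq fun t => consensusFlow a t r j := by
    refine Metric.cauchySeq_iff'.2 fun κ hκ => ?_
    obtain ⟨N, hN⟩ := hclose κ hκ
    exact ⟨N, fun t ht => hN t ht N le_rfl r r⟩
  obtain ⟨ν, hν⟩ := cauchySeq_tendsto_of_complete hcauchy
  refine ⟨ν, fun i => tendsto_of_tendsto_of_dist hν ?_⟩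
  refine Metric.tendsto_atTop.2 fun κ hκ => ?_
  obtain ⟨N, hN⟩ := hclose κ hκ
  refine ⟨N, fun t ht => ?_⟩
  rw [Real.dist_0_eq_abs, abs_of_nonneg dist_nonneg]
  exact hN t ht t ht r i

end FlowLimit

/-! ### Logarithm and exponential of unit quaternions -/

/-- At a zero of `f` the difference quotient of the product is `g` times that of `f`, so `g` need
only be continuous. This handles the identity rotation, where `arccos` and the norm are not
differentiable. -/
theorem HasDerivWithinAt.smul_of_eq_zero {F : Type*} [NormedAddCommGroup F] [NormedSpace ℝ F]
    {g : ℝ → ℝ} {f : ℝ → F} {f' : F} {s : Set ℝ} {t : ℝ} (hg : ContinuousWithinAt g s t)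
    (hf : HasDerivWithinAt f f' s t) (h0 : f t = 0) :
    HasDerivWithinAt (fun u => g u • f u) (g t • f') s t := by
  rw [hasDerivWithinAt_iff_tendsto_slope] at hf ⊢
  have := Filter.Tendsto.smul (hg.mono (Set.sdiff_subset (t := {t}))).tendsto hf
  refine this.congr fun u => ?_
  simp [slope, h0, smul_comm (g u)]

namespace DualQuat

theorem norm_eq_one_of_isUnitNorm {x : DualQuat} (hx : IsUnitNorm x) : ‖x.fst‖ = 1 := by
  have h := congrArg TrivSqZeroExt.fst hx
  simp [conj, Quaternion.self_mul_star] at h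
  rw [Quaternion.normSq_eq_norm_mul_self] at h
  have h2 : ‖x.fst‖ * ‖x.fst‖ = 1 := by simpa using congrArg (·.re) h
  nlinarith [norm_nonneg x.fst]

theorem norm_sq_im (r : ℍ[ℝ]) : ‖r.im‖ ^ 2 = r.imI ^ 2 + r.imJ ^ 2 + r.imK ^ 2 := by
  rw [sq, ← Quaternion.normSq_eq_norm_mul_self, Quaternion.normSq_def']
  simp

theorem norm_sq_eq (r : ℍ[ℝ]) : ‖r‖ ^ 2 = r.re ^ 2 + ‖r.im‖ ^ 2 := by
  rw [norm_sq_im, sq, ← Quaternion.normSq_eq_norm_mul_self, Quaternion.normSq_def']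
  ring

theorem norm_im_eq_sin_arccos {r : ℍ[ℝ]} (hr : ‖r‖ = 1) :
    ‖r.im‖ = Real.sin (Real.arccos r.re) := by
  rw [Real.sin_arccos, eq_comm, Real.sqrt_eq_iff_eq_sq]
  all_goals nlinarith [norm_sq_eq r, norm_nonneg r.im, sq_nonneg ‖r.im‖]

theorem abs_re_le_one {r : ℍ[ℝ]} (hr : ‖r‖ = 1) : |r.re| ≤ 1 := by
  rw [abs_le]; constructor <;> nlinarith [norm_sq_eq r, sq_nonneg ‖r.im‖]

theorem eq_of_im_eq_zero {r : ℍ[ℝ]} (h : r.im = 0) : r = (r.re : ℍ[ℝ]) := by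
  have := Quaternion.re_add_im r
  rw [h, add_zero] at this
  exact this.symm

theorem neg_one_lt_re {r : ℍ[ℝ]} (hr : ‖r‖ = 1) (h : r ≠ -1) : -1 < r.re := by
  refine lt_of_le_of_ne (abs_le.1 (abs_re_le_one hr)).1 fun h1 => h ?_
  have h2 := norm_sq_eq r
  have h3 : ‖r.im‖ = 0 := by
    rw [hr, ← h1] at h2; nlinarith [norm_nonneg r.im]
  rw [eq_of_im_eq_zero (norm_eq_zero.1 h3), ← h1]
  simp

/-- The scalar factor between the imaginary part of a unit quaternion and its logarithm. -/
def logFactor (x : ℝ) : ℝ := (Real.sinc (Real.arccos x))⁻¹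

/-- This form needs no rotation axis and is regular at `r = 1`. At `r = -1` both sides are `0`, so
no exclusion is needed. -/
theorem qlog_eq {r : ℍ[ℝ]} (hr : ‖r‖ = 1) : qlog r = logFactor r.re • r.im := by
  by_cases him : r.im = 0
  · simp [qlog, rotAxis, him]
  have hs := norm_im_eq_sin_arccos hr
  have hs0 : Real.sin (Real.arccos r.re) ≠ 0 := by rw [← hs]; simpa using him
  have hθ : Real.arccos r.re ≠ 0 := fun h => hs0 (by rw [h, Real.sin_zero])
  rw [qlog, rotAxis, rotAngle, logFactor, Real.sinc_of_ne_zero hθ, hs, smul_smul, inv_div]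
  congr 1
  field_simp

/-- The pure quaternion with given coordinates. -/
def pure3 (w : Fin 3 → ℝ) : ℍ[ℝ] := ⟨0, w 0, w 1, w 2⟩

theorem sinc_pos {x : ℝ} (h0 : 0 ≤ x) (h : x < Real.pi) : 0 < Real.sinc x := by
  rcases h0.eq_or_lt with rfl | h0
  · simp
  · rw [Real.sinc_of_ne_zero h0.ne']
    exact div_pos (Real.sin_pos_of_pos_of_lt_pi h0 h) h0

theorem arccos_lt_pi {x : ℝ} (h : -1 < x) : Real.arccos x < Real.pi :=
  lt_of_le_of_ne (Real.arccos_le_pi x) fun h1 => not_le.2 h (Real.arccos_eq_pi.1 h1)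

theorem continuousAt_logFactor {x : ℝ} (h : -1 < x) : ContinuousAt logFactor x := by
  refine ContinuousAt.inv₀ ?_ (sinc_pos (Real.arccos_nonneg x) (arccos_lt_pi h)).ne'
  exact (Real.continuous_sinc.comp Real.continuous_arccos).continuousAt

theorem hasDerivAt_logFactor {x : ℝ} (h : -1 < x) (h1 : x < 1) :
    HasDerivAt logFactor
      (-(Real.sin (Real.arccos x) - Real.arccos x * x) / Real.sin (Real.arccos x) ^ 3) x := by
  have hs : 0 < Real.sin (Real.arccos x) :=
    Real.sin_pos_of_pos_of_lt_pi (Real.arccos_pos.2 h1) (arccos_lt_pi h)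
  have heq : logFactor =ᶠ[𝓝 x] fun y => Real.arccos y / Real.sin (Real.arccos y) := by
    filter_upwards [Iio_mem_nhds h1] with y hy
    rw [logFactor, Real.sinc_of_ne_zero (Real.arccos_pos.2 hy).ne', inv_div]
  have hd := Real.hasDerivAt_arccos h.ne' h1.ne
  have := (hd.div ((Real.hasDerivAt_sin _).comp x hd) hs.ne').congr_of_eventuallyEq heq
  refine this.congr_deriv ?_
  rw [← Real.sin_arccos, Real.cos_arccos h.le h1.le]
  simp only [Function.comp_apply]
  field_simp
  ring

theorem hasDerivWithinAt_re {r : ℝ → ℍ[ℝ]} {r' : ℍ[ℝ]} {s : Set ℝ} {t : ℝ}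
    (h : HasDerivWithinAt r r' s t) : HasDerivWithinAt (fun u => (r u).re) r'.re s t :=
  let e : ℍ[ℝ] →ₗ[ℝ] ℝ :=
    { toFun := fun q => q.re, map_add' := fun _ _ => rfl, map_smul' := fun _ _ => by simp }
  (LinearMap.toContinuousLinearMap e).hasFDerivAt.comp_hasDerivWithinAt t h

theorem hasDerivWithinAt_im {r : ℝ → ℍ[ℝ]} {r' : ℍ[ℝ]} {s : Set ℝ} {t : ℝ}
    (h : HasDerivWithinAt r r' s t) : HasDerivWithinAt (fun u => (r u).im) r'.im s t :=
  let e : ℍ[ℝ] →ₗ[ℝ] ℍ[ℝ] :=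
    { toFun := fun q => q.im, map_add' := fun _ _ => by ext <;> simp,
      map_smul' := fun _ _ => by ext <;> simp }
  (LinearMap.toContinuousLinearMap e).hasFDerivAt.comp_hasDerivWithinAt t h

/-- `matQ` is the Jacobian of the exponential; rather than inverting it, the logarithm is
differentiated along the curve and the given velocity substituted. -/
theorem hasDerivWithinAt_qlog {r : ℝ → ℍ[ℝ]} {r' : ℍ[ℝ]} {s : Set ℝ} {t : ℝ} {w : Fin 3 → ℝ}
    (hs : ∀ u ∈ s, ‖r u‖ = 1) (ht : t ∈ s) (hne : r t ≠ -1) (hr : HasDerivWithinAt r r' s t)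
    (hw : vec4 r' = (matQ (r t)).mulVec w) :
    HasDerivWithinAt (fun u => qlog (r u)) (pure3 w) s t := by
  have h1 := neg_one_lt_re (hs t ht) hne
  suffices h : HasDerivWithinAt (fun u => logFactor (r u).re • (r u).im) (pure3 w) s t from
    h.congr (fun u hu => qlog_eq (hs u hu)) (qlog_eq (hs t ht))
  have hre := hasDerivWithinAt_re hr
  have him := hasDerivWithinAt_im hr
  have e0 := congrFun hw 0
  have e1 := congrFun hw 1
  have e2 := congrFun hw 2
  have e3 := congrFun hw 3
  have hnorm := norm_im_eq_sin_arccos (hs t ht)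
  simp [vec4, matQ, Matrix.mulVec, dotProduct, Fin.sum_univ_three, rotAngle, rotAxis] at e0 e1 e2 e3
  rw [hnorm] at e1 e2 e3
  rcases (abs_le.1 (abs_re_le_one (hs t ht))).2.eq_or_lt with h2 | h2
  · have h0 : (r t).im = 0 := by rw [← norm_eq_zero, hnorm, h2]; simp
    have := HasDerivWithinAt.smul_of_eq_zero
      (ContinuousAt.comp_continuousWithinAt (continuousAt_logFactor h1) hre.continuousWithinAt)
      him h0
    refine this.congr_deriv ?_
    have hI : (r t).imI = 0 := by simpa using congrArg (·.imI) h0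
    have hJ : (r t).imJ = 0 := by simpa using congrArg (·.imJ) h0
    have hK : (r t).imK = 0 := by simpa using congrArg (·.imK) h0
    simp [h2, hI, hJ, hK] at e1 e2 e3
    ext <;> simp [logFactor, h2, pure3, e1, e2, e3]
  · have hθ := Real.arccos_pos.2 h2
    have hsin := Real.sin_pos_of_pos_of_lt_pi hθ (arccos_lt_pi h1)
    have := ((hasDerivAt_logFactor h1 h2).comp_hasDerivWithinAt t hre).fun_smul him
    refine this.congr_deriv ?_
    have hsq : Real.sin (Real.arccos (r t).re) ^ 2
        = (r t).imI ^ 2 + (r t).imJ ^ 2 + (r t).imK ^ 2 := by rw [← hnorm, norm_sq_im]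
    rw [Real.sinc_of_ne_zero hθ.ne'] at e1 e2 e3
    simp only [Function.comp_apply, logFactor, Real.sinc_of_ne_zero hθ.ne']
    generalize Real.arccos (r t).re = θ at *
    generalize hS : Real.sin θ = S at *
    -- The terms along `Im r` cancel: the factor's derivative contributes
    -- $(S-\theta\,\mathrm{Re}\,r)/S^3$ times $\langle \mathrm{Im}\,r,w\rangle$, and $\Gamma$ the
    -- opposite.
    ext
    · simp [pure3]
    · simp [pure3, e0, e1]
      field_simp
      ring_nf
    · simp [pure3, e0, e2]
      field_simp
      ring_nf
    · simp [pure3, e0, e3]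
      field_simp
      ring_nf

/-! ### The quaternion exponential, inverse to the logarithm -/

/-- The exponential `cos |v| + (sin |v| / |v|) v` of a pure quaternion. -/
def qexp (v : ℍ[ℝ]) : ℍ[ℝ] := (Real.cos ‖v‖ : ℍ[ℝ]) + Real.sinc ‖v‖ • v

theorem continuous_qexp : Continuous qexp := by
  unfold qexp
  have h1 : Continuous fun v : ℍ[ℝ] => Real.cos ‖v‖ := Real.continuous_cos.comp continuous_norm
  exact (Quaternion.continuous_coe.comp h1).add
    ((Real.continuous_sinc.comp continuous_norm).smul continuous_id)

theorem sinc_mul_self (x : ℝ) : Real.sinc x * x = Real.sin x := by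
  by_cases h : x = 0
  · simp [h]
  · rw [Real.sinc_of_ne_zero h]; field_simp

theorem re_qexp {v : ℍ[ℝ]} (hv : v.re = 0) : (qexp v).re = Real.cos ‖v‖ := by simp [qexp, hv]

theorem im_qexp {v : ℍ[ℝ]} (hv : v.re = 0) : (qexp v).im = Real.sinc ‖v‖ • v := by
  ext <;> simp [qexp, hv]

theorem norm_qexp {v : ℍ[ℝ]} (hv : v.re = 0) : ‖qexp v‖ = 1 := by
  have h := norm_sq_eq (qexp v)
  rw [re_qexp hv, im_qexp hv, norm_smul, mul_pow, Real.norm_eq_abs, sq_abs, ← mul_pow,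
    sinc_mul_self, Real.cos_sq_add_sin_sq] at h
  nlinarith [norm_nonneg (qexp v)]

theorem rotAngle_qexp {v : ℍ[ℝ]} (hv : v.re = 0) (h : ‖v‖ < Real.pi) :
    rotAngle (qexp v) / 2 = ‖v‖ := by
  rw [rotAngle, re_qexp hv, Real.arccos_cos (norm_nonneg _) h.le]
  ring

theorem rotAxis_qexp {v : ℍ[ℝ]} (hv : v.re = 0) (h : ‖v‖ < Real.pi) :
    rotAxis (qexp v) = ‖v‖⁻¹ • v := by
  have hs := sinc_pos (norm_nonneg v) h
  rw [rotAxis, im_qexp hv, norm_smul, smul_smul, Real.norm_of_nonneg hs.le]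
  congr 1
  field_simp

theorem qlog_qexp {v : ℍ[ℝ]} (hv : v.re = 0) (h : ‖v‖ < Real.pi) : qlog (qexp v) = v := by
  rw [qlog, rotAngle_qexp hv h, rotAxis_qexp hv h]
  by_cases h0 : v = 0
  · simp [h0]
  · rw [smul_smul, mul_inv_cancel₀ (norm_ne_zero_iff.2 h0), one_smul]

theorem qlog_re (r : ℍ[ℝ]) : (qlog r).re = 0 := by simp [qlog, rotAxis]

theorem norm_qlog {r : ℍ[ℝ]} (hr : ‖r‖ = 1) (hne : r ≠ -1) : ‖qlog r‖ = Real.arccos r.re := by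
  have h1 := neg_one_lt_re hr hne
  have hs := sinc_pos (Real.arccos_nonneg r.re) (arccos_lt_pi h1)
  rw [qlog_eq hr, norm_smul, norm_im_eq_sin_arccos hr, logFactor, norm_inv,
    Real.norm_of_nonneg hs.le, ← sinc_mul_self]
  field_simp

theorem qexp_qlog {r : ℍ[ℝ]} (hr : ‖r‖ = 1) (hne : r ≠ -1) : qexp (qlog r) = r := by
  have h1 := neg_one_lt_re hr hne
  have hs := sinc_pos (Real.arccos_nonneg r.re) (arccos_lt_pi h1)
  have hre := abs_le.1 (abs_re_le_one hr)
  rw [qexp, norm_qlog hr hne, Real.cos_arccos hre.1 hre.2, qlog_eq hr, logFactor, smul_smul,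
    mul_inv_cancel₀ hs.ne', one_smul, Quaternion.re_add_im]

theorem norm_qlog_lt_pi {r : ℍ[ℝ]} (hr : ‖r‖ = 1) (hne : r ≠ -1) : ‖qlog r‖ < Real.pi := by
  rw [norm_qlog hr hne]
  exact arccos_lt_pi (neg_one_lt_re hr hne)

theorem qexp_ne_neg_one {v : ℍ[ℝ]} (hv : v.re = 0) (h : ‖v‖ < Real.pi) : qexp v ≠ -1 := by
  intro h1
  have h2 := re_qexp hv
  rw [h1, Quaternion.re_neg, Quaternion.re_one, ← Real.cos_pi] at h2
  exact h.ne' (Real.injOn_cos ⟨Real.pi_pos.le, le_rfl⟩ ⟨norm_nonneg v, h.le⟩ h2)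

theorem hasDerivWithinAt_coe {f : ℝ → ℝ} {f' : ℝ} {s : Set ℝ} {t : ℝ}
    (h : HasDerivWithinAt f f' s t) :
    HasDerivWithinAt (fun u => (f u : ℍ[ℝ])) (f' : ℍ[ℝ]) s t := by
  have := h.smul_const (1 : ℍ[ℝ])
  have e : ∀ x : ℝ, (x : ℍ[ℝ]) = x • 1 := fun x => by ext <;> simp
  simp only [e]
  exact this

@[simp] theorem re_pure3 (w : Fin 3 → ℝ) : (pure3 w).re = 0 := rfl

@[simp] theorem imI_pure3 (w : Fin 3 → ℝ) : (pure3 w).imI = w 0 := rfl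

@[simp] theorem imJ_pure3 (w : Fin 3 → ℝ) : (pure3 w).imJ = w 1 := rfl

@[simp] theorem imK_pure3 (w : Fin 3 → ℝ) : (pure3 w).imK = w 2 := rfl

theorem hasDerivAt_sinc {x : ℝ} (hx : x ≠ 0) :
    HasDerivAt Real.sinc ((Real.cos x * x - Real.sin x) / x ^ 2) x := by
  have heq : Real.sinc =ᶠ[𝓝 x] fun y => Real.sin y / y := by
    filter_upwards [isOpen_ne.mem_nhds hx] with y hy
    exact Real.sinc_of_ne_zero hy
  refine (((Real.hasDerivAt_sin x).div (hasDerivAt_id x) hx).congr_of_eventuallyEq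
    heq).congr_deriv ?_
  simp

theorem inner_eq (a b : ℍ[ℝ]) : inner ℝ a b
    = a.re * b.re + a.imI * b.imI + a.imJ * b.imJ + a.imK * b.imK := by
  rw [Quaternion.inner_def]
  simp

/-- A coordinate-free form of the Jacobian. At `v = 0` the term with `‖v‖⁻¹` vanishes, so its
default value is harmless. -/
theorem matQ_qexp_mulVec {v : ℍ[ℝ]} (hre : v.re = 0) (hpi : ‖v‖ < Real.pi) (w : Fin 3 → ℝ) :
    (matQ (qexp v)).mulVec w =
      vec4 (((-Real.sinc ‖v‖ * inner ℝ v (pure3 w) : ℝ) : ℍ[ℝ]) + Real.sinc ‖v‖ • pure3 w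
        + ((Real.cos ‖v‖ - Real.sinc ‖v‖) * (‖v‖⁻¹ ^ 2 * inner ℝ v (pure3 w))) • v) := by
  have hI : (qexp v).imI = Real.sinc ‖v‖ * v.imI := by
    simpa using congrArg (·.imI) (im_qexp hre)
  have hJ : (qexp v).imJ = Real.sinc ‖v‖ * v.imJ := by
    simpa using congrArg (·.imJ) (im_qexp hre)
  have hK : (qexp v).imK = Real.sinc ‖v‖ * v.imK := by
    simpa using congrArg (·.imK) (im_qexp hre)
  rw [inner_eq]
  ext k
  fin_cases k <;>
  · simp [matQ, Matrix.mulVec, dotProduct, Fin.sum_univ_three, rotAngle_qexp hre hpi,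
      rotAxis_qexp hre hpi, re_qexp hre, hI, hJ, hK, vec4, hre]
    ring

theorem hasDerivWithinAt_qexp {v : ℝ → ℍ[ℝ]} {w : Fin 3 → ℝ} {s : Set ℝ} {t : ℝ}
    (hre : (v t).re = 0) (hpi : ‖v t‖ < Real.pi) (hv : HasDerivWithinAt v (pure3 w) s t) :
    ∃ r', HasDerivWithinAt (fun u => qexp (v u)) r' s t ∧
      vec4 r' = (matQ (qexp (v t))).mulVec w := by
  refine ⟨_, ?_, (matQ_qexp_mulVec hre hpi w).symm⟩
  have hsq := hv.norm_sq
  by_cases h0 : v t = 0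
  · have hc : ContinuousWithinAt (fun u => ‖v u‖) s t := hv.continuousWithinAt.norm
    have hcos : HasDerivWithinAt (fun u => Real.cos ‖v u‖) 0 s t := by
      -- From $\cos x=1-\tfrac12\,\mathrm{sinc}(x/2)^2x^2$: only the squared norm, differentiable at
      -- `0`, has to be differentiated.
      have hg : ContinuousWithinAt (fun u => -(1 / 2 : ℝ) * Real.sinc (‖v u‖ / 2) ^ 2) s t :=
        ContinuousWithinAt.mul continuousWithinAt_const
          ((Real.continuous_sinc.continuousAt.comp_continuousWithinAt (hc.div_const 2)).pow 2)
      have h1 := (HasDerivWithinAt.smul_of_eq_zero hg hsq (by simp [h0])).const_add 1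
      refine (h1.congr_deriv (by simp [h0])).congr_of_eventuallyEq (.of_forall fun u => ?_) ?_
      · have h1 := Real.cos_two_mul (‖v u‖ / 2)
        have h2 := Real.sin_sq_add_cos_sq (‖v u‖ / 2)
        have h3 := sinc_mul_self (‖v u‖ / 2)
        rw [mul_div_cancel₀ _ two_ne_zero] at h1
        simp only [h1, smul_eq_mul]
        linear_combination 2 * h2
          + (2 * Real.sin (‖v u‖ / 2) + Real.sinc (‖v u‖ / 2) * ‖v u‖) * h3
      · simp [h0]
    have hsinc : ContinuousWithinAt (fun u => Real.sinc ‖v u‖) s t :=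
      Real.continuous_sinc.continuousAt.comp_continuousWithinAt hc
    refine ((hasDerivWithinAt_coe hcos).add
      (HasDerivWithinAt.smul_of_eq_zero hsinc hv h0)).congr_deriv ?_
    simp [h0]
  · have hN : 0 < ‖v t‖ := norm_pos_iff.2 h0
    have hn : HasDerivWithinAt (fun u => ‖v u‖) (‖v t‖⁻¹ * inner ℝ (v t) (pure3 w)) s t := by
      have := hsq.sqrt (by positivity)
      simp only [Real.sqrt_sq (norm_nonneg _)] at this
      refine this.congr_deriv ?_
      field_simp
    have hcos := (Real.hasDerivAt_cos _).comp_hasDerivWithinAt t hn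
    have hsinc := (hasDerivAt_sinc hN.ne').comp_hasDerivWithinAt t hn
    refine ((hasDerivWithinAt_coe hcos).add (hsinc.fun_smul hv)).congr_deriv ?_
    simp only [Function.comp_apply, Real.sinc_of_ne_zero hN.ne']
    rw [add_assoc]
    congr 2
    · field_simp
    · congr 1
      field_simp

/-! ### Calculus and unit norm for dual quaternions -/

theorem fst_mul (x y : DualQuat) : (x * y).fst = x.fst * y.fst := rfl

theorem snd_mul (x y : DualQuat) : (x * y).snd = x.fst * y.snd + x.snd * y.fst := rfl

@[simp] theorem fst_conj (x : DualQuat) : (conj x).fst = star x.fst := by simp [conj]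

@[simp] theorem snd_conj (x : DualQuat) : (conj x).snd = star x.snd := by simp [conj]

/-- The real part, a continuous linear map. -/
def fstL : DualQuat →L[ℝ] ℍ[ℝ] :=
  { toFun := TrivSqZeroExt.fst, map_add' := fun _ _ => rfl, map_smul' := fun _ _ => rfl,
    cont := TrivSqZeroExt.continuous_fst }

/-- The dual part, a continuous linear map. -/
def sndL : DualQuat →L[ℝ] ℍ[ℝ] :=
  { toFun := TrivSqZeroExt.snd, map_add' := fun _ _ => rfl, map_smul' := fun _ _ => rfl,
    cont := TrivSqZeroExt.continuous_snd }

/-- Quaternions as dual quaternions without dual part, a continuous linear map. -/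
def inlL : ℍ[ℝ] →L[ℝ] DualQuat :=
  { toFun := TrivSqZeroExt.inl, map_add' := fun _ _ => by ext <;> simp,
    map_smul' := fun _ _ => by ext <;> simp, cont := TrivSqZeroExt.continuous_inl }

/-- Quaternions as dual parts, a continuous linear map. -/
def inrL : ℍ[ℝ] →L[ℝ] DualQuat :=
  { toFun := TrivSqZeroExt.inr, map_add' := fun _ _ => by ext <;> simp,
    map_smul' := fun _ _ => by ext <;> simp, cont := TrivSqZeroExt.continuous_inr }

/-- The conjugation of quaternions, a continuous linear map. -/
def starL : ℍ[ℝ] →L[ℝ] ℍ[ℝ] :=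
  LinearMap.toContinuousLinearMap
    { toFun := star, map_add' := fun _ _ => star_add _ _, map_smul' := fun _ _ => by ext <;> simp }

section Deriv

variable {x : ℝ → DualQuat} {x' : DualQuat} {s : Set ℝ} {t : ℝ}

theorem hasDerivWithinAt_fst (h : HasDerivWithinAt x x' s t) :
    HasDerivWithinAt (fun u => (x u).fst) x'.fst s t :=
  fstL.hasFDerivAt.comp_hasDerivWithinAt t h

theorem hasDerivWithinAt_snd (h : HasDerivWithinAt x x' s t) :
    HasDerivWithinAt (fun u => (x u).snd) x'.snd s t :=
  sndL.hasFDerivAt.comp_hasDerivWithinAt t h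

theorem hasDerivWithinAt_inl_add_inr {f g : ℝ → ℍ[ℝ]} {f' g' : ℍ[ℝ]}
    (hf : HasDerivWithinAt f f' s t) (hg : HasDerivWithinAt g g' s t) :
    HasDerivWithinAt (fun u => (TrivSqZeroExt.inl (f u) + TrivSqZeroExt.inr (g u) : DualQuat))
      (TrivSqZeroExt.inl f' + TrivSqZeroExt.inr g') s t :=
  (inlL.hasFDerivAt.comp_hasDerivWithinAt t hf).add (inrL.hasFDerivAt.comp_hasDerivWithinAt t hg)

theorem hasDerivWithinAt_of_fst_snd (h1 : HasDerivWithinAt (fun u => (x u).fst) x'.fst s t)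
    (h2 : HasDerivWithinAt (fun u => (x u).snd) x'.snd s t) : HasDerivWithinAt x x' s t := by
  simpa only [TrivSqZeroExt.inl_fst_add_inr_snd_eq] using hasDerivWithinAt_inl_add_inr h1 h2

theorem hasDerivWithinAt_star {f : ℝ → ℍ[ℝ]} {f' : ℍ[ℝ]} (hf : HasDerivWithinAt f f' s t) :
    HasDerivWithinAt (fun u => star (f u)) (star f') s t :=
  starL.hasFDerivAt.comp_hasDerivWithinAt t hf

theorem hasDerivWithinAt_conj (h : HasDerivWithinAt x x' s t) :
    HasDerivWithinAt (fun u => conj (x u)) (conj x') s t :=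
  hasDerivWithinAt_inl_add_inr (hasDerivWithinAt_star (hasDerivWithinAt_fst h))
    (hasDerivWithinAt_star (hasDerivWithinAt_snd h))

theorem hasDerivWithinAt_mul {y : ℝ → DualQuat} {y' : DualQuat} (hx : HasDerivWithinAt x x' s t)
    (hy : HasDerivWithinAt y y' s t) :
    HasDerivWithinAt (fun u => x u * y u) (x' * y t + x t * y') s t := by
  have hx1 := hasDerivWithinAt_fst hx
  have hx2 := hasDerivWithinAt_snd hx
  have hy1 := hasDerivWithinAt_fst hy
  have hy2 := hasDerivWithinAt_snd hy
  refine hasDerivWithinAt_of_fst_snd (hx1.fun_mul hy1)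
    (((hx1.fun_mul hy2).fun_add (hx2.fun_mul hy1)).congr_deriv ?_)
  simp only [TrivSqZeroExt.snd_add, snd_mul]
  abel

end Deriv

/-- The dual part of `x * conj x` is `x.snd * star x.fst` plus its own conjugate, that is, twice its
real part. -/
theorem isUnitNorm_iff {x : DualQuat} :
    IsUnitNorm x ↔ ‖x.fst‖ = 1 ∧ (x.snd * star x.fst).re = 0 := by
  constructor
  · intro h
    refine ⟨norm_eq_one_of_isUnitNorm h, ?_⟩
    have h2 := congrArg (fun z => z.snd.re) h
    simp at h2
    simp
    linarith
  · rintro ⟨h1, h2⟩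
    refine TrivSqZeroExt.ext ?_ ?_
    · rw [fst_mul, fst_conj, Quaternion.self_mul_star, Quaternion.normSq_eq_norm_mul_self, h1]
      simp
    · simp at h2
      simp only [snd_mul, fst_conj, snd_conj, TrivSqZeroExt.snd_one]
      ext
      · simp; linarith
      all_goals simp; ring

theorem IsUnitNorm.conj_mul_self {x : DualQuat} (h : IsUnitNorm x) : conj x * x = 1 := by
  obtain ⟨h1, h2⟩ := isUnitNorm_iff.1 h
  refine TrivSqZeroExt.ext ?_ ?_
  · rw [fst_mul, fst_conj, Quaternion.star_mul_self, Quaternion.normSq_eq_norm_mul_self, h1]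
    simp
  · simp at h2
    simp only [snd_mul, fst_conj, snd_conj, TrivSqZeroExt.snd_one]
    ext
    · simp; linarith
    all_goals simp; ring

theorem conj_mul (x y : DualQuat) : conj (x * y) = conj y * conj x := by
  refine TrivSqZeroExt.ext ?_ ?_
  · simp
  · simp [add_comm]

theorem conj_conj (x : DualQuat) : conj (conj x) = x := by
  refine TrivSqZeroExt.ext ?_ ?_ <;> simp

theorem IsUnitNorm.mul {x y : DualQuat} (hx : IsUnitNorm x) (hy : IsUnitNorm y) :
    IsUnitNorm (x * y) := by
  unfold IsUnitNorm at *
  rw [conj_mul, mul_assoc, ← mul_assoc y, hy, one_mul, hx]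

theorem IsUnitNorm.conj {x : DualQuat} (hx : IsUnitNorm x) : IsUnitNorm (conj x) := by
  unfold IsUnitNorm
  rw [conj_conj]
  exact IsUnitNorm.conj_mul_self hx

/-! ### Coordinates -/

theorem vec4_injective : Function.Injective vec4 := by
  intro g h e
  ext
  · exact congrFun e 0
  · exact congrFun e 1
  · exact congrFun e 2
  · exact congrFun e 3

theorem vec4_surjective : Function.Surjective vec4 := fun w =>
  ⟨⟨w 0, w 1, w 2, w 3⟩, by ext k; fin_cases k <;> rfl⟩

theorem vec8_eq_iff {x y : DualQuat} : vec8 x = vec8 y ↔ x = y := by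
  refine ⟨fun h => ?_, fun h => h ▸ rfl⟩
  refine TrivSqZeroExt.ext (vec4_injective ?_) (vec4_injective ?_)
  · exact funext fun k => congrFun h (Sum.inl k)
  · exact funext fun k => congrFun h (Sum.inr k)

theorem vec8_surjective : Function.Surjective vec8 := fun w => by
  obtain ⟨g, hg⟩ := vec4_surjective (w ∘ Sum.inl)
  obtain ⟨h, hh⟩ := vec4_surjective (w ∘ Sum.inr)
  refine ⟨TrivSqZeroExt.inl g + TrivSqZeroExt.inr h, ?_⟩
  simp [vec8, hg, hh]

theorem vec4_add (g h : ℍ[ℝ]) : vec4 (g + h) = vec4 g + vec4 h := by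
  ext k; fin_cases k <;> simp [vec4]

theorem vec4_neg (g : ℍ[ℝ]) : vec4 (-g) = -vec4 g := by
  ext k; fin_cases k <;> simp [vec4]

theorem vec4_smul (c : ℝ) (g : ℍ[ℝ]) : vec4 (c • g) = c • vec4 g := by
  ext k; fin_cases k <;> simp [vec4]

theorem vec8_add (x y : DualQuat) : vec8 (x + y) = vec8 x + vec8 y := by
  ext (k | k) <;> simp [vec8, vec4_add]

theorem vec8_neg (x : DualQuat) : vec8 (-x) = -vec8 x := by
  ext (k | k) <;> simp [vec8, vec4_neg]

theorem hamiPlus4_mulVec (g h : ℍ[ℝ]) : (hamiPlus4 g).mulVec (vec4 h) = vec4 (g * h) := by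
  ext k
  fin_cases k <;> simp [hamiPlus4, vec4, Matrix.mulVec, dotProduct, Fin.sum_univ_four] <;> ring

theorem hamiMinus4_mulVec (g h : ℍ[ℝ]) : (hamiMinus4 h).mulVec (vec4 g) = vec4 (g * h) := by
  ext k
  fin_cases k <;> simp [hamiMinus4, vec4, Matrix.mulVec, dotProduct, Fin.sum_univ_four] <;> ring

theorem hamiMinus8_mulVec (g x : DualQuat) : (hamiMinus8 x).mulVec (vec8 g) = vec8 (g * x) := by
  rw [hamiMinus8, vec8, Matrix.fromBlocks_mulVec]
  simp only [Function.comp_def, Sum.elim_inl, Sum.elim_inr, hamiMinus4_mulVec, Matrix.zero_mulVec,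
    add_zero, ← vec4_add]
  rfl

theorem matQp_mulVec (w : Fin 3 → ℝ) : matQp.mulVec w = vec4 (pure3 w) := by
  ext k
  fin_cases k <;> simp [matQp, vec4, Matrix.mulVec, dotProduct, Fin.sum_univ_three]

/-- The lower block row is the Leibniz rule for $\tfrac12 p\,r$, with $\tfrac12 p$ equal to `x.snd *
star x.fst`. -/
theorem vec8_eq_matQ8_mulVec_iff {x x' : DualQuat} {w : Fin 3 ⊕ Fin 3 → ℝ} :
    vec8 x' = (matQ8 x).mulVec w ↔ vec4 x'.fst = (matQ x.fst).mulVec (w ∘ Sum.inl) ∧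
      x'.snd = x.snd * star x.fst * x'.fst + pure3 (w ∘ Sum.inr) * x.fst := by
  rw [matQ8, Matrix.fromBlocks_mulVec, vec8, Sum.elim_eq_iff]
  rw [Matrix.zero_mulVec, add_zero]
  refine and_congr_right fun h => ?_
  rw [Matrix.smul_mulVec, ← Matrix.mulVec_mulVec, ← Matrix.mulVec_mulVec, matQp_mulVec, ← h,
    hamiPlus4_mulVec, hamiMinus4_mulVec, ← vec4_smul, ← vec4_add, vec4_injective.eq_iff,
    translation, smul_mul_assoc, smul_smul]
  norm_num

/-- The pure dual quaternion with given coordinates. -/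
def pure6 (w : Fin 3 ⊕ Fin 3 → ℝ) : DualQuat :=
  TrivSqZeroExt.inl (pure3 (w ∘ Sum.inl)) + TrivSqZeroExt.inr (pure3 (w ∘ Sum.inr))

theorem IsUnitNorm.star_mul_self {x : DualQuat} (h : IsUnitNorm x) : star x.fst * x.fst = 1 := by
  simpa [fst_mul] using congrArg TrivSqZeroExt.fst h.conj_mul_self

theorem IsUnitNorm.mul_star_self {x : DualQuat} (h : IsUnitNorm x) : x.fst * star x.fst = 1 := by
  simpa [fst_mul] using congrArg TrivSqZeroExt.fst h

theorem log_eq (x : DualQuat) :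
    log x = TrivSqZeroExt.inl (qlog x.fst) + TrivSqZeroExt.inr (x.snd * star x.fst) := by
  simp [log, translation, smul_smul]

/-- Differentiating $r r^*=1$ determines the derivative of $r^*$; in the Leibniz rule for $p\,r^*$
everything but `w` then cancels. -/
theorem hasDerivWithinAt_mul_star {r p : ℝ → ℍ[ℝ]} {r' p' w : ℍ[ℝ]} {s : Set ℝ} {t : ℝ}
    (hs : ∀ u ∈ s, r u * star (r u) = 1) (ht : t ∈ s) (hs' : star (r t) * r t = 1)
    (hsd : UniqueDiffWithinAt ℝ s t) (hr : HasDerivWithinAt r r' s t)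
    (hp : HasDerivWithinAt p p' s t) (hw : p' = p t * star (r t) * r' + w * r t) :
    HasDerivWithinAt (fun u => p u * star (r u)) w s t := by
  have hr2 := hasDerivWithinAt_star hr
  have h1 : HasDerivWithinAt (fun u => r u * star (r u)) (r' * star (r t) + r t * star r') s t :=
    hr.fun_mul hr2
  have h2 : HasDerivWithinAt (fun u => r u * star (r u)) 0 s t :=
    (hasDerivWithinAt_const t s (1 : ℍ[ℝ])).congr hs (hs t ht)
  have hone : r' * star (r t) + r t * star r' = 0 := hsd.eq_deriv _ h1 h2
  have h3 : HasDerivWithinAt (fun u => p u * star (r u)) (p' * star (r t) + p t * star r') s t :=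
    hp.fun_mul hr2
  refine h3.congr_deriv ?_
  have hrt := hs t ht
  generalize r t = q at *
  generalize p t = q' at *
  have e : p' * star q + q' * star r'
      = q' * star q * (r' * star q + q * star r') + w * (q * star q) := by
    have : q' * star r' = q' * (star q * q) * star r' := by rw [hs', mul_one]
    rw [hw, this]
    simp only [mul_add, add_mul, mul_assoc]
    abel
  rw [e, hone, hrt, mul_zero, zero_add, mul_one]

theorem hasDerivWithinAt_log {x : ℝ → DualQuat} {x' : DualQuat} {s : Set ℝ} {t : ℝ}
    {w : Fin 3 ⊕ Fin 3 → ℝ} (hs : ∀ u ∈ s, IsUnitNorm (x u)) (ht : t ∈ s)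
    (hsd : UniqueDiffWithinAt ℝ s t) (hne : (x t).fst ≠ -1) (hx : HasDerivWithinAt x x' s t)
    (hw : vec8 x' = (matQ8 (x t)).mulVec w) :
    HasDerivWithinAt (fun u => log (x u)) (pure6 w) s t := by
  obtain ⟨h1, h2⟩ := vec8_eq_matQ8_mulVec_iff.1 hw
  have hf := hasDerivWithinAt_fst hx
  have hg := hasDerivWithinAt_snd hx
  simp only [log_eq]
  exact hasDerivWithinAt_inl_add_inr
    (hasDerivWithinAt_qlog (fun u hu => norm_eq_one_of_isUnitNorm (hs u hu)) ht hne hf h1)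
    (hasDerivWithinAt_mul_star (fun u hu => (hs u hu).mul_star_self) ht
      (hs t ht).star_mul_self hsd hf hg h2)

/-! ### The exponential of pure dual quaternions -/

/-- The exponential of a pure dual quaternion. -/
def dexp (y : DualQuat) : DualQuat :=
  TrivSqZeroExt.inl (qexp y.fst) + TrivSqZeroExt.inr (y.snd * qexp y.fst)

theorem continuous_dexp : Continuous dexp := by
  have h := continuous_qexp.comp (TrivSqZeroExt.continuous_fst (R := ℍ[ℝ]) (M := ℍ[ℝ]))
  exact (TrivSqZeroExt.continuous_inl.comp h).add
    (TrivSqZeroExt.continuous_inr.comp (TrivSqZeroExt.continuous_snd.mul h))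

/-- Pure dual quaternions whose rotation vector is shorter than `π`. -/
def IsLog (y : DualQuat) : Prop := y.fst.re = 0 ∧ y.snd.re = 0 ∧ ‖y.fst‖ < Real.pi

@[simp] theorem fst_dexp (y : DualQuat) : (dexp y).fst = qexp y.fst := by simp [dexp]

@[simp] theorem snd_dexp (y : DualQuat) : (dexp y).snd = y.snd * qexp y.fst := by simp [dexp]

theorem qexp_mul_star {v : ℍ[ℝ]} (hv : v.re = 0) : qexp v * star (qexp v) = 1 := by
  rw [Quaternion.self_mul_star, Quaternion.normSq_eq_norm_mul_self, norm_qexp hv]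
  simp

theorem isUnitNorm_dexp {y : DualQuat} (h1 : y.fst.re = 0) (h2 : y.snd.re = 0) :
    IsUnitNorm (dexp y) := by
  rw [isUnitNorm_iff, fst_dexp, snd_dexp, mul_assoc, qexp_mul_star h1, mul_one]
  exact ⟨norm_qexp h1, h2⟩

theorem IsLog.inLogDomain_dexp {y : DualQuat} (h : IsLog y) : InLogDomain (dexp y) :=
  ⟨isUnitNorm_dexp h.1 h.2.1, by rw [fst_dexp]; exact qexp_ne_neg_one h.1 h.2.2⟩

theorem IsLog.log_dexp {y : DualQuat} (h : IsLog y) : log (dexp y) = y := by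
  rw [log_eq, fst_dexp, snd_dexp, qlog_qexp h.1 h.2.2, mul_assoc, qexp_mul_star h.1, mul_one,
    TrivSqZeroExt.inl_fst_add_inr_snd_eq]

@[simp] theorem fst_log (x : DualQuat) : (log x).fst = qlog x.fst := by simp [log]

@[simp] theorem snd_log (x : DualQuat) : (log x).snd = x.snd * star x.fst := by simp [log_eq]

theorem InLogDomain.isLog_log {x : DualQuat} (h : InLogDomain x) : IsLog (log x) := by
  obtain ⟨h1, h2⟩ := isUnitNorm_iff.1 h.1
  refine ⟨?_, ?_, ?_⟩
  · rw [fst_log, qlog_re]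
  · rw [snd_log, h2]
  · rw [fst_log]; exact norm_qlog_lt_pi h1 h.2

theorem InLogDomain.dexp_log {x : DualQuat} (h : InLogDomain x) : dexp (log x) = x := by
  refine TrivSqZeroExt.ext ?_ ?_
  · rw [fst_dexp, fst_log, qexp_qlog (norm_eq_one_of_isUnitNorm h.1) h.2]
  · rw [snd_dexp, fst_log, snd_log, qexp_qlog (norm_eq_one_of_isUnitNorm h.1) h.2, mul_assoc,
      h.1.star_mul_self, mul_one]

theorem hasDerivWithinAt_dexp {y : ℝ → DualQuat} {s : Set ℝ} {t : ℝ} {w : Fin 3 ⊕ Fin 3 → ℝ}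
    (hlog : IsLog (y t)) (hy : HasDerivWithinAt y (pure6 w) s t) :
    ∃ x', HasDerivWithinAt (fun u => dexp (y u)) x' s t ∧
      vec8 x' = (matQ8 (dexp (y t))).mulVec w := by
  have hf := hasDerivWithinAt_fst hy
  have hg := hasDerivWithinAt_snd hy
  simp only [pure6, TrivSqZeroExt.fst_add, TrivSqZeroExt.fst_inl, TrivSqZeroExt.fst_inr, add_zero,
    TrivSqZeroExt.snd_add, TrivSqZeroExt.snd_inl, TrivSqZeroExt.snd_inr, zero_add] at hf hg
  obtain ⟨r', hr, hr'⟩ := hasDerivWithinAt_qexp hlog.1 hlog.2.2 hf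
  refine ⟨_, hasDerivWithinAt_inl_add_inr hr (hg.fun_mul hr), vec8_eq_matQ8_mulVec_iff.2 ⟨?_, ?_⟩⟩
  · simpa using hr'
  · rw [fst_dexp, snd_dexp, mul_assoc (y t).snd, qexp_mul_star hlog.1]
    simp [add_comm]

theorem pure6_sum_smul {ι : Type*} [Fintype ι] (c : ι → ℝ) (w : ι → Fin 3 ⊕ Fin 3 → ℝ) :
    pure6 (-∑ j, c j • w j) = -∑ j, c j • pure6 (w j) := by
  let L : (Fin 3 ⊕ Fin 3 → ℝ) →ₗ[ℝ] DualQuat :=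
    { toFun := pure6
      map_add' := fun _ _ => by
        refine TrivSqZeroExt.ext ?_ ?_ <;> ext <;> simp [pure6]
      map_smul' := fun _ _ => by
        refine TrivSqZeroExt.ext ?_ ?_ <;> ext <;> simp [pure6] }
  change L (-∑ j, c j • w j) = -∑ j, c j • L (w j)
  simp

theorem pure6_vec6 {y : DualQuat} (h1 : y.fst.re = 0) (h2 : y.snd.re = 0) :
    pure6 (vec6 y) = y := by
  refine TrivSqZeroExt.ext ?_ ?_ <;> ext <;> simp [pure6, vec6, vec3, h1, h2]

theorem norm_sum_smul_le {ι F : Type*} [Fintype ι] [NormedAddCommGroup F] [NormedSpace ℝ F]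
    {w : ι → ℝ} {v : ι → F} {μ : ℝ} (hw : ∀ j, 0 ≤ w j) (hw1 : ∑ j, w j = 1)
    (hv : ∀ j, ‖v j‖ ≤ μ) : ‖∑ j, w j • v j‖ ≤ μ :=
  calc ‖∑ j, w j • v j‖ ≤ ∑ j, w j * μ := norm_sum_le_of_le _ fun j _ => by
        rw [norm_smul, Real.norm_of_nonneg (hw j)]
        exact mul_le_mul_of_nonneg_left (hv j) (hw j)
    _ = μ := by rw [← Finset.sum_mul, hw1, one_mul]

theorem fst_sum_smul {ι : Type*} [Fintype ι] (w : ι → ℝ) (y : ι → DualQuat) :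
    (∑ j, w j • y j).fst = ∑ j, w j • (y j).fst := by
  change fstL (∑ j, w j • y j) = ∑ j, w j • fstL (y j)
  simp only [map_sum, map_smul]

theorem snd_sum_smul {ι : Type*} [Fintype ι] (w : ι → ℝ) (y : ι → DualQuat) :
    (∑ j, w j • y j).snd = ∑ j, w j • (y j).snd := by
  change sndL (∑ j, w j • y j) = ∑ j, w j • sndL (y j)
  simp only [map_sum, map_smul]

theorem re_sum_smul_eq_zero {ι : Type*} [Fintype ι] {w : ι → ℝ} {q : ι → ℍ[ℝ]}
    (hq : ∀ j, (q j).re = 0) : (∑ j, w j • q j).re = 0 :=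
  Finset.sum_induction _ (fun z : ℍ[ℝ] => z.re = 0) (fun u v hu hv => by simp [hu, hv]) rfl
    fun j _ => by simp [hq]

end DualQuat

/-! ### Linearisation and existence of motions -/

section ClosedLoop

open DualQuat

variable {n : ℕ} {a : Matrix (Fin n) (Fin n) ℝ} {δ x : Fin n → ℝ → DualQuat}

/-- The feedforward term cancels $x_i\dot\delta_i^*$, and multiplication by $\delta_i$ is undone by
$\delta_i\delta_i^*=1$. No logarithm has to be defined, so the centres are continuous at all times.
-/
theorem IsClosedLoopMotion.hasDerivWithinAt_center
    (hδ : ∀ i t, 0 ≤ t → IsUnitNorm (δ i t))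
    (hδd : ∀ i, DifferentiableOn ℝ (δ i) (Set.Ici 0)) (hx : IsClosedLoopMotion a δ x)
    (i : Fin n) {t : ℝ} (ht : 0 ≤ t) :
    ∃ c', HasDerivWithinAt (center δ x i) c' (Set.Ici 0) t ∧
      vec8 c' = (matQ8 (center δ x i t)).mulVec
        (-∑ j, a i j • vec6 (output δ x i t - output δ x j t)) := by
  obtain ⟨x', hx', hv⟩ := hx.dynamics i t ht
  have hc := hasDerivWithinAt_conj (hδd i t ht).hasDerivWithinAt
  have hd := hc.derivWithin (uniqueDiffOn_Ici 0 t ht)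
  obtain ⟨g, hg⟩ := vec8_surjective ((matQ8 (center δ x i t)).mulVec
        (∑ j, a i j • vec6 (output δ x i t - output δ x j t)))
  have hδδ : δ i t * conj (δ i t) = 1 := hδ i t ht
  have hx'eq : x' = -(g * δ i t) + -(x i t * derivWithin (fun s => conj (δ i s)) (Set.Ici 0) t
      * δ i t) := by
    rw [← vec8_eq_iff, hv, protocolInput, ← hg, hamiMinus8_mulVec, vec8_add, vec8_neg, vec8_neg,
      sub_eq_add_neg]
  refine ⟨-g, (hasDerivWithinAt_mul hx' hc).congr_deriv ?_, ?_⟩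
  · rw [hx'eq, hd, add_mul, neg_mul, neg_mul, mul_assoc g, mul_assoc (x i t * _), hδδ]
    simp
  · rw [vec8_neg, hg, Matrix.mulVec_neg]

theorem IsClosedLoopMotion.isUnitNorm_center (hδ : ∀ i t, 0 ≤ t → IsUnitNorm (δ i t))
    (hx : IsClosedLoopMotion a δ x) (i : Fin n) {t : ℝ} (ht : 0 ≤ t) :
    IsUnitNorm (center δ x i t) :=
  (hx.isUnitNorm i t ht).mul (hδ i t ht).conj

theorem DualQuat.IsUnitNorm.pure_log {x : DualQuat} (h : IsUnitNorm x) :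
    (log x).fst.re = 0 ∧ (log x).snd.re = 0 := by
  rw [fst_log, snd_log]
  exact ⟨qlog_re _, (isUnitNorm_iff.1 h).2⟩

theorem pure6_feedback {y : Fin n → DualQuat} (hy : ∀ i, (y i).fst.re = 0 ∧ (y i).snd.re = 0)
    (i : Fin n) : pure6 (-∑ j, a i j • vec6 (y i - y j)) = ∑ j, negLaplacian a i j • y j := by
  rw [pure6_sum_smul, sum_negLaplacian_smul]
  congr 1
  refine Finset.sum_congr rfl fun j _ => ?_
  rw [pure6_vec6] <;> simp [hy]

/-- Only agent `i` must avoid rotation `-1`: the formal logarithm of any unit pose is pure, so the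
neighbours' outputs enter merely as values. -/
theorem IsClosedLoopMotion.hasDerivWithinAt_output
    (hδ : ∀ i t, 0 ≤ t → IsUnitNorm (δ i t))
    (hδd : ∀ i, DifferentiableOn ℝ (δ i) (Set.Ici 0)) (hx : IsClosedLoopMotion a δ x)
    (i : Fin n) {t : ℝ} (ht : 0 ≤ t) (hne : (center δ x i t).fst ≠ -1) :
    HasDerivWithinAt (output δ x i) (∑ j, negLaplacian a i j • output δ x j t)
      (Set.Ici 0) t := by
  obtain ⟨c', hc, hv⟩ := hx.hasDerivWithinAt_center hδ hδd i ht
  have := hasDerivWithinAt_log (s := Set.Ici 0) (fun u hu => hx.isUnitNorm_center hδ i hu) ht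
    (uniqueDiffOn_Ici 0 t ht) hne hc hv
  rwa [pure6_feedback (y := fun j => output δ x j t)
    fun j => (hx.isUnitNorm_center hδ j ht).pure_log] at this

/-- As long as the outputs stay defined, they follow the consensus flow. -/
theorem IsClosedLoopMotion.output_eq
    (hδ : ∀ i t, 0 ≤ t → IsUnitNorm (δ i t))
    (hδd : ∀ i, DifferentiableOn ℝ (δ i) (Set.Ici 0)) (hx : IsClosedLoopMotion a δ x)
    {T : ℝ} (hT : 0 ≤ T) (hne : ∀ i, ∀ t ∈ Set.Icc 0 T, (center δ x i t).fst ≠ -1) (i : Fin n) :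
    output δ x i T = ∑ j, consensusFlow a T i j • output δ x j 0 :=
  eq_sum_consensusFlow_smul hT
    (fun i t ht => hx.hasDerivWithinAt_output hδ hδd i ht.1 (hne i t ht)) i

/-- The outputs stay defined: rotation vectors remain in the convex hull of the initial ones. -/
theorem IsClosedLoopMotion.inLogDomain (ha : ∀ i j, 0 ≤ a i j)
    (hδ : ∀ i t, 0 ≤ t → IsUnitNorm (δ i t))
    (hδd : ∀ i, DifferentiableOn ℝ (δ i) (Set.Ici 0)) (hx : IsClosedLoopMotion a δ x)
    (i : Fin n) {t : ℝ} (ht : 0 ≤ t) : InLogDomain (center δ x i t) := by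
  have : Nonempty (Fin n) := ⟨i⟩
  obtain ⟨i₀, hi₀⟩ := Finite.exists_max fun i => ‖(output δ x i 0).fst‖
  set μ := ‖(output δ x i₀ 0).fst‖
  have hμ : μ < Real.pi := (hx.init i₀).isLog_log.2.2
  have hcont : ∀ i, ContinuousOn (fun t => (center δ x i t).fst.re) (Set.Ici 0) := by
    intro i t ht
    obtain ⟨c', hc, -⟩ := hx.hasDerivWithinAt_center hδ hδd i ht
    exact (hasDerivWithinAt_re (hasDerivWithinAt_fst hc)).continuousWithinAt
  -- The bound on rotation vectors is recast as one on real parts, which are continuous even where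
  -- the logarithm is not.
  have hgood : ∀ T, 0 ≤ T → (∀ i, ∀ t ∈ Set.Icc 0 T, (center δ x i t).fst ≠ -1) →
      ∀ i, Real.cos μ ≤ (center δ x i T).fst.re := by
    intro T hT hne i
    have h1 := hx.output_eq hδ hδd hT hne i
    have hu := hx.isUnitNorm_center hδ i hT
    have h2 : ‖(output δ x i T).fst‖ ≤ μ := by
      rw [h1, fst_sum_smul]
      exact norm_sum_smul_le (consensusFlow_nonneg ha hT i) (sum_consensusFlow a T i) hi₀
    have hn := norm_eq_one_of_isUnitNorm hu
    have hre := abs_le.1 (abs_re_le_one hn)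
    rw [output, fst_log, norm_qlog hn (hne i T ⟨hT, le_rfl⟩)] at h2
    rw [← Real.cos_arccos hre.1 hre.2]
    exact Real.cos_le_cos_of_nonneg_of_le_pi (Real.arccos_nonneg _) hμ.le h2
  have hcos : -1 < Real.cos μ := by
    rw [← Real.cos_pi]
    exact Real.cos_lt_cos_of_nonneg_of_le_pi (norm_nonneg _) le_rfl hμ
  refine ⟨hx.isUnitNorm_center hδ i ht, ?_⟩
  by_contra hbad
  -- The bad times form a closed set, so there is a first one, `T`. Real parts are at least `cos μ >
  -- -1` before `T`, hence also at `T`.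
  let B : Set ℝ := ⋃ i, Set.Ici 0 ∩ (fun t => (center δ x i t).fst.re) ⁻¹' Set.Iic (-1)
  have hB : IsClosed B := isClosed_iUnion_of_finite fun i =>
    (hcont i).preimage_isClosed_of_isClosed isClosed_Ici isClosed_Iic
  have hBne : B.Nonempty := ⟨t, Set.mem_iUnion.2 ⟨i, ht, by simp [hbad]⟩⟩
  have hBb : BddBelow B := ⟨0, fun s hs => by
    obtain ⟨j, hj⟩ := Set.mem_iUnion.1 hs
    exact hj.1⟩
  set T := sInf B
  obtain ⟨j, hT, hj⟩ := Set.mem_iUnion.1 (hB.csInf_mem hBne hBb)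
  have hT : 0 ≤ T := hT
  have hbefore : ∀ s, 0 ≤ s → s < T → ∀ i, (center δ x i s).fst ≠ -1 := by
    intro s hs hsT i hi
    exact notMem_of_lt_csInf hsT hBb (Set.mem_iUnion.2 ⟨i, hs, by simp [hi]⟩)
  have hj : (center δ x j T).fst.re ≤ -1 := hj
  have hT0 : 0 < T := by
    refine lt_of_le_of_ne hT fun h0 => ?_
    have := neg_one_lt_re (norm_eq_one_of_isUnitNorm (hx.init j).1) (hx.init j).2
    rw [← h0] at hj
    linarith
  have hlim : Filter.Tendsto (fun t => (center δ x j t).fst.re) (𝓝[Set.Ico 0 T] T)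
      (𝓝 (center δ x j T).fst.re) :=
    ((hcont j) T hT).mono_left (nhdsWithin_mono _ Set.Ico_subset_Ici_self)
  have hnb : (𝓝[Set.Ico 0 T] T).NeBot := by
    rw [← mem_closure_iff_nhdsWithin_neBot, closure_Ico hT0.ne]
    exact ⟨hT, le_rfl⟩
  have := ge_of_tendsto hlim (eventually_nhdsWithin_of_forall fun s hs =>
    hgood s hs.1 (fun k u hu => hbefore u hu.1 (hu.2.trans_lt hs.2) k) j)
  linarith

theorem IsClosedLoopMotion.output_eq_consensusFlow (ha : ∀ i j, 0 ≤ a i j)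
    (hδ : ∀ i t, 0 ≤ t → IsUnitNorm (δ i t))
    (hδd : ∀ i, DifferentiableOn ℝ (δ i) (Set.Ici 0)) (hx : IsClosedLoopMotion a δ x)
    {t : ℝ} (ht : 0 ≤ t) (i : Fin n) :
    output δ x i t = ∑ j, consensusFlow a t i j • output δ x j 0 :=
  hx.output_eq hδ hδd ht (fun i _ hs => (hx.inLogDomain ha hδ hδd i hs.1).2) i

theorem center_mul_self (hδ : ∀ i t, 0 ≤ t → IsUnitNorm (δ i t)) (c : Fin n → ℝ → DualQuat)
    (i : Fin n) {t : ℝ} (ht : 0 ≤ t) : center δ (fun i t => c i t * δ i t) i t = c i t := by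
  have hδδ : δ i t * conj (δ i t) = 1 := hδ i t ht
  rw [center, mul_assoc, hδδ, mul_one]

theorem eq_neg_of_isUnitNorm {d : ℝ → DualQuat} {d' : DualQuat} {s : Set ℝ} {t : ℝ}
    (hs : ∀ u ∈ s, IsUnitNorm (d u)) (ht : t ∈ s) (hsd : UniqueDiffWithinAt ℝ s t)
    (hd : HasDerivWithinAt d d' s t) : d' = -(d t * conj d' * d t) := by
  have h1 : HasDerivWithinAt (fun u => d u * conj (d u)) (d' * conj (d t) + d t * conj d') s t :=
    hasDerivWithinAt_mul hd (hasDerivWithinAt_conj hd)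
  have h2 : HasDerivWithinAt (fun u => d u * conj (d u)) 0 s t :=
    (hasDerivWithinAt_const t s (1 : DualQuat)).congr hs (hs t ht)
  have h3 := congrArg (· * d t) (hsd.eq_deriv _ h1 h2)
  simp only [add_mul, mul_assoc, (hs t ht).conj_mul_self, mul_one, zero_mul] at h3
  rw [mul_assoc]
  exact eq_neg_of_add_eq_zero_left h3

/-- The motion is explicit: the linear flow of the initial logarithms, exponentiated and multiplied
by `δ`. Convexity keeps the flow in the ball where the logarithm inverts the exponential. -/
theorem exists_isClosedLoopMotion (ha : ∀ i j, 0 ≤ a i j)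
    (hδ : ∀ i t, 0 ≤ t → IsUnitNorm (δ i t))
    (hδd : ∀ i, DifferentiableOn ℝ (δ i) (Set.Ici 0)) (x₀ : Fin n → DualQuat)
    (hx₀ : ∀ i, InLogDomain (x₀ i * conj (δ i 0))) :
    ∃ x : Fin n → ℝ → DualQuat, IsClosedLoopMotion a δ x ∧ ∀ i, x i 0 = x₀ i := by
  let y₀ : Fin n → DualQuat := fun i => log (x₀ i * conj (δ i 0))
  have hy₀ : ∀ i, IsLog (y₀ i) := fun i => (hx₀ i).isLog_log
  let y : Fin n → ℝ → DualQuat := fun i t => ∑ j, consensusFlow a t i j • y₀ j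
  have hy0 : ∀ i, y i 0 = y₀ i := fun i => by
    simp [y, consensusFlow_zero, Matrix.one_apply, ite_smul]
  have hylog : ∀ i t, 0 ≤ t → IsLog (y i t) := by
    intro i t ht
    have : Nonempty (Fin n) := ⟨i⟩
    obtain ⟨i₀, hi₀⟩ := Finite.exists_max fun i => ‖(y₀ i).fst‖
    refine ⟨?_, ?_, ?_⟩
    · rw [fst_sum_smul]
      exact re_sum_smul_eq_zero fun j => (hy₀ j).1
    · rw [snd_sum_smul]
      exact re_sum_smul_eq_zero fun j => (hy₀ j).2.1
    · rw [fst_sum_smul]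
      exact (norm_sum_smul_le (consensusFlow_nonneg ha ht i) (sum_consensusFlow a t i)
        hi₀).trans_lt (hy₀ i₀).2.2
  have hyd : ∀ i t, HasDerivAt (y i) (∑ j, negLaplacian a i j • y j t) t := by
    intro i t
    have := HasDerivAt.fun_sum (u := Finset.univ) fun j _ =>
      (hasDerivAt_consensusFlow_apply' a t i j).smul_const (y₀ j)
    refine this.congr_deriv ?_
    simp only [y, Matrix.mul_apply, Finset.sum_smul, Finset.smul_sum, smul_smul]
    rw [Finset.sum_comm]
  have hcenter : ∀ i t, 0 ≤ t →
      center δ (fun i t => dexp (y i t) * δ i t) i t = dexp (y i t) := fun i t ht =>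
    center_mul_self hδ (fun i t => dexp (y i t)) i ht
  have hout : ∀ i t, 0 ≤ t → output δ (fun i t => dexp (y i t) * δ i t) i t = y i t :=
    fun i t ht => by rw [output, hcenter i t ht, (hylog i t ht).log_dexp]
  refine ⟨fun i t => dexp (y i t) * δ i t, ⟨?_, ?_, ?_⟩, ?_⟩
  · exact fun i t ht => (hylog i t ht).inLogDomain_dexp.1.mul (hδ i t ht)
  · intro i
    rw [hcenter i 0 le_rfl]
    exact (hylog i 0 le_rfl).inLogDomain_dexp
  · intro i t ht
    have hyi := (hyd i t).hasDerivWithinAt (s := Set.Ici 0)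
    rw [← pure6_feedback (y := fun j => y j t)
      fun j => ⟨(hylog j t ht).1, (hylog j t ht).2.1⟩] at hyi
    obtain ⟨c', hc, hv⟩ := hasDerivWithinAt_dexp (hylog i t ht) hyi
    have hδi := (hδd i t ht).hasDerivWithinAt
    have hconj := hasDerivWithinAt_conj hδi
    set δ' := derivWithin (δ i) (Set.Ici 0) t
    have hd := hconj.derivWithin (uniqueDiffOn_Ici 0 t ht)
    refine ⟨_, hasDerivWithinAt_mul hc hδi, ?_⟩
    rw [protocolInput, hcenter i t ht, hd]
    simp only [hout _ t ht]
    rw [← Matrix.mulVec_neg, ← Matrix.mulVec_neg, ← hv, hamiMinus8_mulVec, sub_eq_add_neg,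
      ← vec8_neg, ← vec8_add]
    congr 2
    -- Since $\delta\delta^*=1$, the Leibniz term with $\dot\delta$ equals the feedforward term.
    have h1 := eq_neg_of_isUnitNorm (s := Set.Ici 0) (fun u hu => hδ i u hu) ht
      (uniqueDiffOn_Ici 0 t ht) hδi
    calc dexp (y i t) * δ' = dexp (y i t) * -(δ i t * conj δ' * δ i t) := by rw [← h1]
      _ = _ := by rw [mul_neg]; simp only [mul_assoc]
  · intro i
    change dexp (y i 0) * δ i 0 = x₀ i
    rw [hy0, (hx₀ i).dexp_log, mul_assoc, (hδ i 0 le_rfl).conj_mul_self, mul_one]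

/-! ### Asymptotics and the graph -/

theorem IsAdjacencyMatrix.nonneg {n : ℕ} {G : Digraph (Fin n)} {a : Matrix (Fin n) (Fin n) ℝ}
    (ha : IsAdjacencyMatrix G a) (i j : Fin n) : 0 ≤ a i j := by
  by_cases h : G.Adj j i
  · exact ((ha.pos_iff i j).2 h).le
  · exact (ha.eq_zero i j h).ge

/-- A value shared by a set of nodes that is closed under taking parents is preserved by the
consensus flow. -/
theorem sum_consensusFlow_smul_eq {ι F : Type*} [Fintype ι] [DecidableEq ι] [AddCommGroup F]
    [Module ℝ F] {a : Matrix ι ι ℝ} {S : Set ι} (hS : ∀ i j, i ∈ S → j ∉ S → a i j = 0)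
    {y : ι → F} {z : F} (hy : ∀ j ∈ S, y j = z) (t : ℝ) {i : ι} (hi : i ∈ S) :
    ∑ j, consensusFlow a t i j • y j = z := by
  classical
  -- The exponential inherits block triangularity, so rows in `S` have no weight outside `S`.
  have hM : (t • negLaplacian a).BlockTriangular fun i => if i ∈ S then 1 else 0 := by
    intro i j hij
    by_cases h1 : i ∈ S <;> by_cases h2 : j ∈ S <;> simp [h1, h2] at hij
    have hne : i ≠ j := fun h => h2 (h ▸ h1)
    simp [negLaplacian, hS i j h1 h2, hne]
  have h0 : ∀ j, j ∉ S → consensusFlow a t i j = 0 := fun j hj => hM.exp (by simp [hi, hj])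
  calc ∑ j, consensusFlow a t i j • y j = ∑ j, consensusFlow a t i j • z := by
        refine Finset.sum_congr rfl fun j _ => ?_
        by_cases hj : j ∈ S
        · rw [hy j hj]
        · rw [h0 j hj, zero_smul, zero_smul]
    _ = z := by rw [← Finset.sum_smul, sum_consensusFlow, one_smul]

variable {n : ℕ} {G : Digraph (Fin n)} {a : Matrix (Fin n) (Fin n) ℝ}
  {δ : Fin n → ℝ → DualQuat}

theorem exists_tendsto_output (ha : IsAdjacencyMatrix G a)
    (hδ : ∀ i t, 0 ≤ t → IsUnitNorm (δ i t))
    (hδd : ∀ i, DifferentiableOn ℝ (δ i) (Set.Ici 0)) (hG : HasDirectedSpanningTree G)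
    {x : Fin n → ℝ → DualQuat} (hx : IsClosedLoopMotion a δ x) :
    ∃ y : DualQuat, IsUnitNorm (dexp y) ∧
      ∀ i, Filter.Tendsto (output δ x i) Filter.atTop (𝓝 y) := by
  obtain ⟨r, hr⟩ := exists_root_of_hasDirectedSpanningTree hG
  obtain ⟨ν, hν⟩ := exists_tendsto_consensusFlow ha.nonneg (r := r) fun i =>
    Relation.ReflTransGen.mono (fun u v h => (ha.pos_iff v u).2 h) _ _ (hr i)
  have hlim : ∀ i, Filter.Tendsto (output δ x i) Filter.atTop
      (𝓝 (∑ j, ν j • output δ x j 0)) := by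
    intro i
    have h : Filter.Tendsto (fun t => ∑ j, consensusFlow a t i j • output δ x j 0) Filter.atTop
        (𝓝 (∑ j, ν j • output δ x j 0)) :=
      tendsto_finsetSum _ fun j _ => (hν i j).smul_const _
    refine h.congr' ?_
    filter_upwards [Filter.eventually_ge_atTop 0] with t ht
    exact (hx.output_eq_consensusFlow ha.nonneg hδ hδd ht i).symm
  refine ⟨_, ?_, hlim⟩
  have hpure : ∀ j, IsLog (output δ x j 0) := fun j => (hx.init j).isLog_log
  refine isUnitNorm_dexp ?_ ?_
  · rw [fst_sum_smul]
    exact re_sum_smul_eq_zero fun j => (hpure j).1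
  · rw [snd_sum_smul]
    exact re_sum_smul_eq_zero fun j => (hpure j).2.1

/-- Two disjoint parent-closed sets start at different outputs and never hear from outside. -/
theorem exists_motion_of_not_hasDirectedSpanningTree (hn : 0 < n) (ha : IsAdjacencyMatrix G a)
    (hδ : ∀ i t, 0 ≤ t → IsUnitNorm (δ i t))
    (hδd : ∀ i, DifferentiableOn ℝ (δ i) (Set.Ici 0)) (hG : ¬ HasDirectedSpanningTree G) :
    ∃ (x : Fin n → ℝ → DualQuat) (i j : Fin n) (y z : DualQuat), IsClosedLoopMotion a δ x ∧
      IsLog y ∧ IsLog z ∧ y ≠ z ∧ ∀ t, 0 ≤ t → output δ x i t = y ∧ output δ x j t = z := by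
  classical
  have : Nonempty (Fin n) := ⟨⟨0, hn⟩⟩
  obtain ⟨A, B, ⟨i, hi⟩, ⟨j, hj⟩, hAB, hA, hB⟩ := exists_disjoint_closed_of_no_root
    fun ⟨r, hr⟩ => hG (hasDirectedSpanningTree_of_root (r := r) hr)
  -- A pure translation: with no rotation, the bound by `π` is automatic.
  let z : DualQuat := TrivSqZeroExt.inr (⟨0, 1, 0, 0⟩ : ℍ[ℝ])
  have hz : IsLog z :=
    ⟨rfl, rfl, by change ‖(0 : ℍ[ℝ])‖ < Real.pi; simp [Real.pi_pos]⟩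
  have h0 : IsLog (0 : DualQuat) := by simp [IsLog, Real.pi_pos]
  let y₀ : Fin n → DualQuat := fun k => if k ∈ A then z else 0
  have hy₀ : ∀ k, IsLog (y₀ k) := by
    intro k
    by_cases hk : k ∈ A
    · simpa [y₀, hk] using hz
    · simpa [y₀, hk] using h0
  have hc₀ : ∀ k, dexp (y₀ k) * δ k 0 * conj (δ k 0) = dexp (y₀ k) := fun k => by
    have : δ k 0 * conj (δ k 0) = 1 := hδ k 0 le_rfl
    rw [mul_assoc, this, mul_one]
  obtain ⟨x, hx, hx0⟩ := exists_isClosedLoopMotion ha.nonneg hδ hδd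
    (fun k => dexp (y₀ k) * δ k 0) fun k => by rw [hc₀]; exact (hy₀ k).inLogDomain_dexp
  have hout0 : ∀ k, output δ x k 0 = y₀ k := fun k => by
    rw [output, center, hx0, hc₀, (hy₀ k).log_dexp]
  refine ⟨x, i, j, z, 0, hx, hz, h0, ?_, fun t ht => ⟨?_, ?_⟩⟩
  · intro h
    have h1 : (1 : ℝ) = 0 := congrArg (fun q => q.snd.imI) h
    exact one_ne_zero h1
  · rw [hx.output_eq_consensusFlow ha.nonneg hδ hδd ht]
    refine sum_consensusFlow_smul_eq (S := A)
      (fun k l hk hl => ha.eq_zero k l fun h => hl (hA l k h hk)) (fun k hk => ?_) t hi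
    rw [hout0]
    exact if_pos hk
  · rw [hx.output_eq_consensusFlow ha.nonneg hδ hδd ht]
    refine sum_consensusFlow_smul_eq (S := B)
      (fun k l hk hl => ha.eq_zero k l fun h => hl (hB l k h hk)) (fun k hk => ?_) t hj
    rw [hout0]
    exact if_neg (Set.disjoint_right.1 hAB hk)

end ClosedLoop

open DualQuat in
theorem mainTheorem6 {n : ℕ} (hn : 0 < n) (G : Digraph (Fin n)) (a : Matrix (Fin n) (Fin n) ℝ)
    (ha : IsAdjacencyMatrix G a) (δ : Fin n → ℝ → DualQuat)
    (hδ : ∀ i t, 0 ≤ t → DualQuat.IsUnitNorm (δ i t))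
    (hδd : ∀ i, DifferentiableOn ℝ (δ i) (Set.Ici 0)) :
    (∀ x₀ : Fin n → DualQuat, (∀ i, DualQuat.IsUnitNorm (x₀ i)) →
      (∀ i, DualQuat.InLogDomain (x₀ i * DualQuat.conj (δ i 0))) →
      ∃ x : Fin n → ℝ → DualQuat, IsClosedLoopMotion a δ x ∧ ∀ i, x i 0 = x₀ i) ∧
    (∀ x : Fin n → ℝ → DualQuat, IsClosedLoopMotion a δ x →
      ∀ i t, 0 ≤ t → DualQuat.InLogDomain (center δ x i t)) ∧
    (AchievesOutputConsensus a δ ↔ HasDirectedSpanningTree G) ∧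
    (AchievesFormation a δ ↔ HasDirectedSpanningTree G) := by
  refine ⟨fun x₀ _ hx₀ => exists_isClosedLoopMotion ha.nonneg hδ hδd x₀ hx₀,
    fun x hx i t ht => hx.inLogDomain ha.nonneg hδ hδd i ht, ⟨fun h => ?_, fun hG x hx i j => ?_⟩,
    ⟨fun h => ?_, fun hG x hx => ?_⟩⟩
  · by_contra hG
    obtain ⟨x, i, j, y, z, hx, -, -, hyz, hout⟩ :=
      exists_motion_of_not_hasDirectedSpanningTree hn ha hδ hδd hG
    have h1 : Filter.Tendsto (fun _ : ℝ => y - z) Filter.atTop (𝓝 0) := by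
      refine (h x hx i j).congr' ?_
      filter_upwards [Filter.eventually_ge_atTop 0] with t ht
      rw [(hout t ht).1, (hout t ht).2]
    exact hyz (sub_eq_zero.1 (tendsto_nhds_unique tendsto_const_nhds h1))
  · obtain ⟨y, -, hy⟩ := exists_tendsto_output ha hδ hδd hG hx
    simpa using (hy i).sub (hy j)
  · by_contra hG
    obtain ⟨x, i, j, y, z, hx, hy, hz, hyz, hout⟩ :=
      exists_motion_of_not_hasDirectedSpanningTree hn ha hδ hδd hG
    obtain ⟨xc, -, hxc⟩ := h x hx
    have key : ∀ k w, (∀ t, 0 ≤ t → output δ x k t = w) → dexp w = xc := by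
      intro k w hw
      refine tendsto_nhds_unique (tendsto_const_nhds (f := Filter.atTop (α := ℝ))) ?_
      refine (hxc k).congr' ?_
      filter_upwards [Filter.eventually_ge_atTop 0] with t ht
      rw [← hw t ht, output, (hx.inLogDomain ha.nonneg hδ hδd k ht).dexp_log]
    -- Both exponentials equal `xc`, and the logarithm recovers `y` and `z` from them.
    apply hyz
    rw [← hy.log_dexp, ← hz.log_dexp, key i y fun t ht => (hout t ht).1,
      key j z fun t ht => (hout t ht).2]
  · obtain ⟨y, hu, hy⟩ := exists_tendsto_output ha hδ hδd hG hx
    refine ⟨dexp y, hu, fun i => ((continuous_dexp.tendsto y).comp (hy i)).congr' ?_⟩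
    filter_upwards [Filter.eventually_ge_atTop 0] with t ht
    exact (hx.inLogDomain ha.nonneg hδ hδd i ht).dexp_log

end
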